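/- For each positive integer $n$, let $S_{\rm lcm}(n)$ be the set of permutations $\pi$ of $\{1,\dots,n\}$ such that $\operatorname{lcm}(j,\pi(j))\le n$ for every $j\in\{1,\dots,n\}$. Then the limit $$c_l=\lim_{n\to\infty}\left(\# S_{\rm lcm}(n)\right)^{1/n}$$ exists as a real number, and it is effectively computable: there is an algorithm which, given $k\in\mathbb{N}$, outputs an integer $m$ with $|c_l-m/2^k|\le 2^{-k}$. Moreover, for every $\epsilon>0$ we have, for $n\ge 3$, $$\# S_{\rm lcm}(n)=c_l^{\,n\left(1+O_\epsilon\left(\exp\left((-1+\epsilon)\sqrt{\log n\,\log\log n}\right)\right)\right)},$$ where the implied constant depends only on $\epsilon$. -/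

import Mathlib

/-- `Slcm n` is the set of permutations `π` of `{1, …, n}` such that `lcm(j, π(j)) ≤ n`
for every `j`. -/
def Slcm (n : ℕ) : Set (Equiv.Perm (Finset.Icc 1 n)) :=
  {π | ∀ j : Finset.Icc 1 n, Nat.lcm (j : ℕ) (π j : ℕ) ≤ n}

/-- A real number `x` is (effectively) computable if some computable function sends each `k` to
an integer `m` with `|x - m / 2 ^ k| ≤ 1 / 2 ^ k`, i.e. if an algorithm outputs
rational approximations to `x` of any prescribed precision. -/
def IsComputableReal (x : ℝ) : Prop :=
  ∃ f : ℕ → ℤ, Computable f ∧ ∀ k : ℕ, |x - (f k : ℝ) / 2 ^ k| ≤ 1 / 2 ^ k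

/-! ### Cycle exchange: the cost of adding one vertex to a graph. -/

section Exchange

open Equiv Equiv.Perm

variable {α : Type*}

/-! Join x and y when lcm(x, y) ≤ n; the permutations to be counted move each vertex along an edge
or a loop. Adding the vertices n, n - 1, ..., 1 one at a time writes log #S as a sum of increments
`lcmIncr n k`. Two properties of the increments drive the proof.

They are small. At its own stage, k has at most ⌊n/k⌋² neighbours (itself included), and a
cycle-exchange argument shows that a new vertex of degree d multiplies the count by at most 2d²
(`ncard_relPerms_le`). So the increment lies between 0 and log 2 + 4 log⌊n/k⌋, and the vertices k ≤
n/2^I contribute only O(n I/2^I).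

They are local. If k = s r and no prime up to n/k divides r, then divisibility by r is constant
along the edges between vertices ≥ k, and the increment equals `lcmIncr (n / r) s` (`lcmIncr_mul`).
Sorting the k in a dyadic range of n/k by their q-smooth part s and by t = ⌊n/r⌋ leaves the task of
counting the q-rough r with ⌊n/r⌋ = t. Brun's pure sieve gives n/(t(t+1)) ∏(1 - 1/p) up to a small
error (`brun_sieve`), and Rankin's bound discards large s (`sum_smooth_rpow_le`). Hence log #S = n C
+ error, where C = `totalCenter` depends only on the truncation parameters (`abs_log_ncard_sub_le`).

For fixed parameters the sieve error is bounded in n, so (log #S)/n ends up near C. For parameters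
adapted to one n (`exists_params`) the whole relative error is at most exp(-(1 - 3ε)√(log n log log
n)). Comparing both estimates around the same C gives convergence and its rate. The limit L is
positive, because independent exchanges of j and 2j already give exponentially many permutations; so
the error may be divided by L and moved into the exponent. Finally #S is primitive recursive in n,
and the rate tells which n suffices for a given precision. -/

theorem perm_apply_inv (σ : Perm α) (x : α) : σ (σ⁻¹ x) = x := σ.apply_symm_apply x

open Classical in
/-- The cycle of `ρ` through `u`. -/
noncomputable def cycleThrough (ρ : Perm α) (u : α) : Perm α := ρ.cycleOf u

theorem cycleThrough_apply {ρ : Perm α} {u x : α} (h : ρ.SameCycle u x) :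
    cycleThrough ρ u x = ρ x := by classical exact h.cycleOf_apply

theorem cycleThrough_apply_of_not {ρ : Perm α} {u x : α} (h : ¬ ρ.SameCycle u x) :
    cycleThrough ρ u x = x := by classical exact cycleOf_apply_of_not_sameCycle h

theorem cycleThrough_apply_self (ρ : Perm α) (u : α) : cycleThrough ρ u u = ρ u :=
  cycleThrough_apply SameCycle.rfl

theorem cycleThrough_inv (ρ : Perm α) (u : α) : (cycleThrough ρ u)⁻¹ = cycleThrough ρ⁻¹ u := by
  classical
  unfold cycleThrough
  rw [cycleOf_inv]
  congr

theorem commute_cycleThrough (ρ : Perm α) (u : α) : Commute (cycleThrough ρ u) ρ := by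
  ext x
  by_cases h : ρ.SameCycle u x
  · simp only [mul_apply]
    rw [cycleThrough_apply h, cycleThrough_apply (sameCycle_apply_right.2 h)]
  · simp only [mul_apply]
    rw [cycleThrough_apply_of_not h,
      cycleThrough_apply_of_not (fun h' => h (sameCycle_apply_right.1 h'))]

/-- With c the cycle of u, ρ c⁻¹ fixes u and commutes with c⁻¹, so it does not affect the cycle of
u. This makes the exchanges below decodable: c can be read off from the exchanged pair. -/
theorem cycleThrough_inv_mul_mul_inv (ρ : Perm α) (u : α) :
    cycleThrough ((cycleThrough ρ u)⁻¹ * (ρ * (cycleThrough ρ u)⁻¹)) u =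
      (cycleThrough ρ u)⁻¹ := by
  classical
  have hc := commute_cycleThrough ρ u
  have hcomm : Commute (cycleThrough ρ u)⁻¹ (ρ * (cycleThrough ρ u)⁻¹) :=
    (hc.inv_left).mul_right (Commute.refl _)
  have hfix : (ρ * (cycleThrough ρ u)⁻¹) u = u := by
    rw [← hc.inv_left.eq, mul_apply, inv_eq_iff_eq, cycleThrough_apply_self]
  have h1 : cycleThrough ((cycleThrough ρ u)⁻¹ * (ρ * (cycleThrough ρ u)⁻¹)) u =
      cycleThrough (cycleThrough ρ u)⁻¹ u := by
    unfold cycleThrough at *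
    rw [cycleOf_mul_of_apply_right_eq_self hcomm u hfix]
    congr
  rw [h1, ← cycleThrough_inv]
  congr 1
  by_cases h : ρ u = u
  · have : cycleThrough ρ u = 1 := by unfold cycleThrough; exact (cycleOf_eq_one_iff ρ).2 h
    rw [this]
    unfold cycleThrough
    rw [cycleOf_eq_one_iff, one_apply]
  · unfold cycleThrough
    exact (isCycle_cycleOf ρ h).cycleOf_eq (by rwa [cycleOf_apply_self])

/-- Splitting a cycle in two by a transposition separates the two points. -/
theorem apply_eq_of_sameCycle_swap_mul [Finite α] [DecidableEq α] {ρ : Perm α} {u w : α}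
    (h : ρ.SameCycle u w) (h' : (swap w (ρ u) * ρ).SameCycle u (ρ u)) : ρ u = w := by
  classical
  obtain ⟨k0, hk0⟩ := h.symm.exists_nat_pow_eq
  have hex : ∃ k, (ρ ^ k) w = u := ⟨k0, hk0⟩
  set k := Nat.find hex with hk
  have hku : (ρ ^ k) w = u := Nat.find_spec hex
  have hmin : ∀ i < k, (ρ ^ i) w ≠ u := fun i hi => Nat.find_min hex hi
  -- The arc w, ρ w, ..., ρ^k w = u is closed under the modified permutation, which sends its end u
  -- back to w. It meets ρ u only if ρ u = w, by minimality of k.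
  have hcl : ∀ j : ℕ, ∃ i ≤ k, ((swap w (ρ u) * ρ) ^ j) u = (ρ ^ i) w := by
    intro j
    induction j with
    | zero => exact ⟨k, le_rfl, by simp [hku]⟩
    | succ j ih =>
      obtain ⟨i, hi, hij⟩ := ih
      rw [pow_succ', mul_apply, hij, mul_apply]
      rcases hi.lt_or_eq with hlt | rfl
      · refine ⟨i + 1, hlt, ?_⟩
        have h1 : ρ ((ρ ^ i) w) = (ρ ^ (i + 1)) w := by rw [pow_succ', mul_apply]
        rw [h1]
        apply swap_apply_of_ne_of_ne
        · intro hw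
          apply hmin (k - (i + 1)) (by omega)
          have : (ρ ^ (k - (i + 1))) ((ρ ^ (i + 1)) w) = u := by
            rw [← mul_apply, ← pow_add, Nat.sub_add_cancel hlt, hku]
          rwa [hw] at this
        · rw [← h1]
          exact fun hw => hmin i hlt (ρ.injective hw)
      · exact ⟨0, Nat.zero_le _, by rw [hku]; simp⟩
  obtain ⟨j, hj⟩ := h'.exists_nat_pow_eq
  obtain ⟨i, hi, hij⟩ := hcl j
  rw [hj] at hij
  rcases Nat.eq_zero_or_pos i with rfl | hpos
  · simpa using hij
  · exfalso
    obtain ⟨m, rfl⟩ : ∃ m, i = m + 1 := ⟨i - 1, by omega⟩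
    rw [pow_succ', mul_apply] at hij
    exact hmin m (by omega) (ρ.injective hij).symm

variable (r : α → α → Prop)

/-- Permutations all of whose steps follow `r`, except that `u` is sent to `w`. -/
def nearPerms (u w : α) : Set (Perm α) := {σ | σ u = w ∧ ∀ x, x ≠ u → r x (σ x)}

/-- Permutations moving every point along `r`. -/
def relPerms : Set (Perm α) := {σ | ∀ x, r x (σ x)}

/-- Let ρ = τ⁻¹σ. On the cycle c of u, σ c⁻¹ agrees with τ and τ c with σ. Since w is off this
cycle, the first exchanged permutation avoids both bad steps u → w and w → u, while the second
collects both; composing it with the transposition of u and w turns them into loops. The inverse map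
applies the same exchange. -/
theorem exchange_disjoint [Finite α] (hr : ∀ x, r x x) (u w : α) :
    {p : Perm α × Perm α | p.1 ∈ nearPerms r u w ∧ p.2 ∈ nearPerms r w u ∧
      ¬ (p.2⁻¹ * p.1).SameCycle u w}.ncard ≤ (relPerms r).ncard ^ 2 := by
  classical
  rw [pow_two, ← Set.ncard_prod]
  apply Set.ncard_le_ncard_of_injOn (fun p : Perm α × Perm α =>
    (p.1 * (cycleThrough (p.2⁻¹ * p.1) u)⁻¹, swap u w * (p.2 * cycleThrough (p.2⁻¹ * p.1) u)))
  · rintro ⟨σ, τ⟩ ⟨⟨hσu, hσ⟩, ⟨hτw, hτ⟩, hsc⟩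
    simp only at hσu hσ hτw hτ hsc
    set ρ := τ⁻¹ * σ with hρ
    have hτρ : ∀ x, τ (ρ x) = σ x := fun x => by simp [hρ]
    refine ⟨fun x => ?_, fun x => ?_⟩
    · simp only [mul_apply, cycleThrough_inv]
      by_cases hx : ρ⁻¹.SameCycle u x
      · rw [cycleThrough_apply hx]
        have : σ (ρ⁻¹ x) = τ x := by rw [← hτρ]; simp
        rw [this]
        apply hτ
        rintro rfl
        exact hsc (sameCycle_inv.1 hx)
      · rw [cycleThrough_apply_of_not hx]
        apply hσ
        rintro rfl
        exact hx SameCycle.rfl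
    · simp only [mul_apply]
      have hcu : τ (cycleThrough ρ u u) = w := by rw [cycleThrough_apply_self, hτρ, hσu]
      have hcw : τ (cycleThrough ρ u w) = u := by rw [cycleThrough_apply_of_not hsc, hτw]
      by_cases hxu : x = u
      · subst hxu; rw [hcu, swap_apply_right]; exact hr _
      by_cases hxw : x = w
      · subst hxw; rw [hcw, swap_apply_left]; exact hr _
      rw [swap_apply_of_ne_of_ne]
      · by_cases hx : ρ.SameCycle u x
        · rw [cycleThrough_apply hx, hτρ]; exact hσ x hxu
        · rw [cycleThrough_apply_of_not hx]; exact hτ x hxw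
      · exact fun h => hxw ((cycleThrough ρ u).injective (τ.injective (h.trans hcw.symm)))
      · exact fun h => hxu ((cycleThrough ρ u).injective (τ.injective (h.trans hcu.symm)))
  · refine Function.Injective.injOn (Function.LeftInverse.injective
      (g := fun p : Perm α × Perm α =>
        (p.1 * (cycleThrough ((swap u w * p.2)⁻¹ * p.1) u)⁻¹,
          swap u w * p.2 * cycleThrough ((swap u w * p.2)⁻¹ * p.1) u)) ?_)
    rintro ⟨p, q⟩
    have h0 : (q * cycleThrough (q⁻¹ * p) u)⁻¹ * (p * (cycleThrough (q⁻¹ * p) u)⁻¹) =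
        (cycleThrough (q⁻¹ * p) u)⁻¹ * ((q⁻¹ * p) * (cycleThrough (q⁻¹ * p) u)⁻¹) := by
      group
    simp only [swap_mul_self_mul]
    rw [h0, cycleThrough_inv_mul_mul_inv, inv_inv]
    rw [inv_mul_cancel_right, mul_inv_cancel_right]

/-- Here the cycle of ρ = τ⁻¹σ is first cut by a transposition so that u steps directly to w; D is
the piece containing both. Exchanging σ and τ along D closes the two bad steps into loops, σ D⁻¹ w =
σ u = w and τ D u = τ w = u. Every other step is a good step of σ or τ. -/
theorem exchange_sameCycle [Finite α] (hr : ∀ x, r x x) (u w : α) :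
    {p : Perm α × Perm α | p.1 ∈ nearPerms r u w ∧ p.2 ∈ nearPerms r w u ∧
      (p.2⁻¹ * p.1).SameCycle u w}.ncard ≤ (relPerms r).ncard ^ 2 := by
  classical
  rw [pow_two, ← Set.ncard_prod]
  let D : Perm α → Perm α := fun ρ => cycleThrough (swap w (ρ u) * ρ) u
  have hDw : ∀ ρ, D ρ u = w := fun ρ => by
    simp only [D]
    rw [cycleThrough_apply_self, mul_apply, swap_apply_right]
  apply Set.ncard_le_ncard_of_injOn (fun p : Perm α × Perm α =>
    (p.1 * (D (p.2⁻¹ * p.1))⁻¹, p.2 * D (p.2⁻¹ * p.1)))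
  · rintro ⟨σ, τ⟩ ⟨⟨hσu, hσ⟩, ⟨hτw, hτ⟩, hsc⟩
    simp only at hσu hσ hτw hτ hsc
    have hdu := hDw (τ⁻¹ * σ)
    simp only [D] at hdu ⊢
    set ρ := τ⁻¹ * σ with hρ
    have hτρ : ∀ x, τ (ρ x) = σ x := fun x => by simp [hρ]
    have hsep := apply_eq_of_sameCycle_swap_mul (ρ := ρ) (u := u) (w := w) hsc
    set ρ₁ := swap w (ρ u) * ρ with hρ₁
    have hρ₁x : ∀ x, x ≠ u → ρ₁.SameCycle u x → ρ₁ x = ρ x := by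
      intro x hxu hx
      rw [hρ₁, mul_apply]
      by_cases hxw : ρ x = w
      · rw [hxw, swap_apply_left]
        apply hsep
        have h1 := sameCycle_apply_right.2 hx
        rwa [show ρ₁ x = ρ u by rw [hρ₁, mul_apply, hxw, swap_apply_left]] at h1
      · exact swap_apply_of_ne_of_ne hxw fun h => hxu (ρ.injective h)
    constructor
    · intro x
      simp only [mul_apply, cycleThrough_inv]
      by_cases hx : ρ₁⁻¹.SameCycle u x
      · rw [cycleThrough_apply hx]
        have hx' : ρ₁.SameCycle u (ρ₁⁻¹ x) :=
          sameCycle_inv.1 (sameCycle_apply_right.2 hx)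
        by_cases hxu : ρ₁⁻¹ x = u
        · have : x = w := by
            rw [inv_eq_iff_eq] at hxu
            rw [hxu, hρ₁, mul_apply, swap_apply_right]
          rw [hxu, hσu, this]
          exact hr w
        · have h1 := hρ₁x _ hxu hx'
          rw [perm_apply_inv] at h1
          rw [← hτρ, ← h1]
          apply hτ
          rintro rfl
          apply hxu
          rw [inv_eq_iff_eq, hρ₁, mul_apply, swap_apply_right]
      · rw [cycleThrough_apply_of_not hx]
        apply hσ
        rintro rfl
        exact hx SameCycle.rfl
    · intro x
      simp only [mul_apply]
      by_cases hxu : x = u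
      · subst hxu
        rw [hdu, hτw]
        exact hr _
      · by_cases hx : ρ₁.SameCycle u x
        · rw [cycleThrough_apply hx, hρ₁x x hxu hx, hτρ]
          exact hσ x hxu
        · rw [cycleThrough_apply_of_not hx]
          apply hτ
          rintro rfl
          apply hx
          rw [← hdu, cycleThrough_apply_self]
          exact sameCycle_apply_right.2 SameCycle.rfl
  · refine Function.Injective.injOn (Function.LeftInverse.injective
      (g := fun p : Perm α × Perm α =>
        (p.1 * (cycleThrough (swap u ((p.2⁻¹ * p.1) w) * (p.2⁻¹ * p.1)) u)⁻¹,
          p.2 * cycleThrough (swap u ((p.2⁻¹ * p.1) w) * (p.2⁻¹ * p.1)) u)) ?_)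
    rintro ⟨p, q⟩
    set ρ := q⁻¹ * p with hρ
    have hd := hDw ρ
    set ρ₁ := swap w (ρ u) * ρ with hρ₁
    have hD : D ρ = cycleThrough ρ₁ u := rfl
    have e0 : (q * D ρ)⁻¹ * (p * (D ρ)⁻¹) = (D ρ)⁻¹ * (ρ * (D ρ)⁻¹) := by
      rw [hρ]; group
    have hinv : (D ρ)⁻¹ w = u := by rw [inv_eq_iff_eq, hd]
    have e1 : (D ρ)⁻¹ * (ρ * (D ρ)⁻¹) =
        swap u ((D ρ)⁻¹ (ρ u)) * ((D ρ)⁻¹ * (ρ₁ * (D ρ)⁻¹)) := by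
      have h0 : ρ * (D ρ)⁻¹ = swap w (ρ u) * (ρ₁ * (D ρ)⁻¹) := by
        rw [← mul_assoc, hρ₁, swap_mul_self_mul]
      have h2 := mul_swap_eq_swap_mul (D ρ)⁻¹ w (ρ u)
      rw [hinv] at h2
      rw [h0, ← mul_assoc, h2, mul_assoc]
    have e2 : ((D ρ)⁻¹ * (ρ * (D ρ)⁻¹)) w = (D ρ)⁻¹ (ρ u) := by
      simp only [mul_apply, hinv]
    have e3 : swap u (((D ρ)⁻¹ * (ρ * (D ρ)⁻¹)) w) * ((D ρ)⁻¹ * (ρ * (D ρ)⁻¹)) =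
        (cycleThrough ρ₁ u)⁻¹ * (ρ₁ * (cycleThrough ρ₁ u)⁻¹) := by
      rw [e2, e1, swap_mul_self_mul, hD]
    rw [← e0, hD] at e3
    beta_reduce
    simp only [← hρ]
    rw [hD, e3, cycleThrough_inv_mul_mul_inv, inv_inv, inv_mul_cancel_right, mul_inv_cancel_right]

theorem ncard_nearPerms_symm (hs : ∀ x y, r x y → r y x) (u w : α) :
    (nearPerms r u w).ncard = (nearPerms r w u).ncard := by
  have h : ∀ u w, ∀ σ ∈ nearPerms r u w, σ⁻¹ ∈ nearPerms r w u := by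
    rintro u w σ ⟨h1, h2⟩
    refine ⟨by rw [inv_eq_iff_eq, h1], fun x hx => ?_⟩
    have := h2 (σ⁻¹ x) (fun h => hx (by rw [← h1, ← h, perm_apply_inv]))
    rw [perm_apply_inv] at this
    exact hs _ _ this
  exact Set.ncard_congr (fun σ _ => σ⁻¹) (h u w) (fun _ _ _ _ h => inv_injective h)
    fun σ hσ => ⟨σ⁻¹, h w u σ hσ, inv_inv σ⟩

/-- Inversion makes the counts for (u, w) and (w, u) equal, and the two exchanges bound their
product by 2R², where R counts the good permutations. The square root √2 R is rounded up to 2R. -/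
theorem ncard_nearPerms_le [Finite α] (hr : ∀ x, r x x) (hs : ∀ x y, r x y → r y x) (u w : α) :
    (nearPerms r u w).ncard ≤ 2 * (relPerms r).ncard := by
  by_cases huw : u = w
  · subst huw
    refine (Set.ncard_le_ncard ?_ (Set.toFinite _)).trans (Nat.le_mul_of_pos_left _ two_pos)
    rintro σ ⟨h1, h2⟩ x
    by_cases hx : x = u
    · subst hx; rw [h1]; exact hr _
    · exact h2 x hx
  have h1 := exchange_disjoint r hr u w
  have h2 := exchange_sameCycle r hr u w
  have h3 : (nearPerms r u w ×ˢ nearPerms r w u).ncard ≤ 2 * (relPerms r).ncard ^ 2 := by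
    rw [two_mul]
    refine le_trans (le_trans (Set.ncard_le_ncard ?_ (Set.toFinite _))
      (Set.ncard_union_le _ _)) (add_le_add h1 h2)
    rintro p ⟨hp, hq⟩
    by_cases h : (p.2⁻¹ * p.1).SameCycle u w
    · exact Or.inr ⟨hp, hq, h⟩
    · exact Or.inl ⟨hp, hq, h⟩
  rw [Set.ncard_prod, ncard_nearPerms_symm r hs w u] at h3
  nlinarith

/-- Adding a vertex `v` multiplies the number of cycle covers by at most twice the square of
its degree. -/
theorem ncard_relPerms_le [Fintype α] (hr : ∀ x, r x x)
    (hs : ∀ x y, r x y → r y x) (v : α) (s : Finset α) (hv : ∀ x, r v x → x ∈ s) :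
    (relPerms r).ncard ≤
      s.card ^ 2 * (2 * (relPerms fun x y : {x // x ≠ v} => r x y).ncard) := by
  classical
  set r' : {x // x ≠ v} → {x // x ≠ v} → Prop := fun x y => r x y with hr'
  -- Sort by the image w and the preimage u of v. Composing with the transposition of v and w fixes
  -- v and sends u straight to w. That step need not follow `r`, which is why near permutations are
  -- needed.
  set A : α × α → Set (Perm α) := fun q => {π | π ∈ relPerms r ∧ π v = q.1 ∧ π q.2 = v} with hA
  have hcov : relPerms r ⊆ ⋃ q ∈ s ×ˢ s, A q := by
    intro π hπ
    simp only [Set.mem_iUnion]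
    refine ⟨(π v, π⁻¹ v), ?_, hπ, rfl, perm_apply_inv _ _⟩
    refine Finset.mem_product.2 ⟨hv _ (hπ v), hv _ (hs _ _ ?_)⟩
    have := hπ (π⁻¹ v)
    rwa [perm_apply_inv] at this
  have hbound : ∀ q ∈ s ×ˢ s, (A q).ncard ≤ 2 * (relPerms r').ncard := by
    rintro ⟨w, u⟩ -
    have himg : ∀ B : Set (Perm {x // x ≠ v}),
        (∀ π ∈ A (w, u), ∀ h, (swap v w * π).subtypePerm (p := fun x => x ≠ v) h ∈ B) →
        (A (w, u)).ncard ≤ B.ncard := by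
      intro B hB
      refine (Set.ncard_le_ncard (t := (fun τ => swap v w * ofSubtype τ) '' B) ?_
        (Set.toFinite _)).trans (Set.ncard_image_le (Set.toFinite _))
      intro π hπ
      have hfix : (swap v w * π) v = v := by rw [mul_apply, hπ.2.1, swap_apply_right]
      have h1 : ∀ x, (swap v w * π) x ≠ v ↔ x ≠ v := fun x => by
        rw [not_iff_not]
        constructor
        · intro h; exact (swap v w * π).injective (h.trans hfix.symm)
        · rintro rfl; exact hfix
      refine ⟨_, hB π hπ h1, ?_⟩
      simp only
      rw [ofSubtype_subtypePerm (p := fun x => x ≠ v) h1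
        (fun x hx hxv => hx (by rw [hxv]; exact hfix)), swap_mul_self_mul]
    by_cases hw : w = v
    · refine (himg (relPerms r') ?_).trans (Nat.le_mul_of_pos_left _ two_pos)
      rintro π hπ h x
      simp only [hr', subtypePerm_apply, hw, swap_self, mul_apply, refl_apply]
      exact hπ.1 x
    · by_cases hu : u = v
      · have : A (w, u) = ∅ := by
          ext π
          simp only [hA, Set.mem_ofPred_eq, Set.mem_empty_iff_false, iff_false]
          rintro ⟨-, h1, h2⟩
          subst hu
          exact hw (h1.symm.trans h2)
        simp [this]
      · refine (himg (nearPerms r' ⟨u, hu⟩ ⟨w, hw⟩) ?_).trans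
          (ncard_nearPerms_le r' (fun x => hr x) (fun x y => hs x y) _ _)
        rintro π ⟨hπ, hπv, hπu⟩ h
        refine ⟨Subtype.ext ?_, fun x hx => ?_⟩
        · simp only [subtypePerm_apply, mul_apply]
          rw [hπu, swap_apply_left]
        · simp only [hr', subtypePerm_apply, mul_apply]
          rw [swap_apply_of_ne_of_ne]
          · exact hπ x
          · exact fun hh => hx (Subtype.ext (π.injective (hh.trans hπu.symm)))
          · exact fun hh => x.2 (π.injective (hh.trans hπv.symm))
  calc (relPerms r).ncard ≤ (⋃ q ∈ s ×ˢ s, A q).ncard := Set.ncard_le_ncard hcov (Set.toFinite _)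
    _ ≤ ∑ q ∈ s ×ˢ s, (A q).ncard := by
        simpa using Finset.set_ncard_biUnion_le (s ×ˢ s) A
    _ ≤ (s ×ˢ s).card • (2 * (relPerms r').ncard) := Finset.sum_le_card_nsmul _ _ _ hbound
    _ = _ := by rw [Finset.card_product, smul_eq_mul, pow_two]

theorem ncard_relPerms_subtype_le [Fintype α] (hr : ∀ x, r x x) (p : α → Prop) :
    (relPerms fun x y : {x // p x} => r x y).ncard ≤ (relPerms r).ncard := by
  classical
  refine Set.ncard_le_ncard_of_injOn (fun τ => ofSubtype τ) ?_
    (Function.Injective.injOn ofSubtype_injective) (Set.toFinite _)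
  intro τ hτ x
  by_cases hx : p x
  · rw [ofSubtype_apply_of_mem τ hx]; exact hτ ⟨x, hx⟩
  · rw [ofSubtype_apply_of_not_mem τ hx]; exact hr x

theorem ncard_relPerms_congr {β : Type*} {r' : β → β → Prop} (e : α ≃ β)
    (h : ∀ x y, r x y ↔ r' (e x) (e y)) : (relPerms r).ncard = (relPerms r').ncard := by
  refine Set.ncard_congr (fun π _ => e.permCongr π) ?_ ?_ ?_
  · intro π hπ y
    have := (h _ _).1 (hπ (e.symm y))
    simpa using this
  · intro a b _ _ hab
    exact e.permCongr.injective hab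
  · intro π hπ
    refine ⟨e.permCongr.symm π, fun x => ?_, e.permCongr.apply_symm_apply π⟩
    rw [h]
    simpa using hπ (e x)

theorem ncard_relPerms_mul [Fintype α] (p : α → Prop) (h : ∀ x y, r x y → (p x ↔ p y)) :
    (relPerms r).ncard = (relPerms fun x y : {x // p x} => r x y).ncard *
      (relPerms fun x y : {x // ¬ p x} => r x y).ncard := by
  classical
  rw [← Set.ncard_prod]
  symm
  refine Set.ncard_congr (fun q _ => Perm.subtypeCongr q.1 q.2) ?_ ?_ ?_
  · rintro ⟨a, b⟩ ⟨ha, hb⟩ x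
    simp only
    by_cases hx : p x
    · rw [Perm.subtypeCongr.left_apply _ _ hx]; exact ha ⟨x, hx⟩
    · rw [Perm.subtypeCongr.right_apply _ _ hx]; exact hb ⟨x, hx⟩
  · rintro a b _ _ hab
    exact subtypeCongrHom_injective p hab
  · intro π hπ
    have h1 : ∀ x, p (π x) ↔ p x := fun x => (h _ _ (hπ x)).symm
    refine ⟨(π.subtypePerm h1, π.subtypePerm fun x => not_congr (h1 x)),
      ⟨fun x => hπ x, fun x => hπ x⟩, ?_⟩
    ext x
    by_cases hx : p x
    · rw [Perm.subtypeCongr.left_apply _ _ hx]; rfl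
    · rw [Perm.subtypeCongr.right_apply _ _ hx]; rfl

end Exchange

/-! ### Counting permutations with small lcm on a vertex set. -/

section LcmCount

open Equiv Equiv.Perm

/-- The number of permutations `π` of `V` with `lcm (j, π j) ≤ n` for all `j ∈ V`. -/
noncomputable def lcmCount (n : ℕ) (V : Finset ℕ) : ℕ :=
  (relPerms fun x y : V => Nat.lcm x y ≤ n).ncard

theorem ncard_Slcm (n : ℕ) : (Slcm n).ncard = lcmCount n (Finset.Icc 1 n) := rfl

variable {n : ℕ} {V : Finset ℕ}

theorem lcmCount_pos (h : ∀ x ∈ V, x ≤ n) : 0 < lcmCount n V := by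
  rw [lcmCount, Set.ncard_pos]
  exact ⟨1, fun x => by simpa using h x x.2⟩

theorem lcmCount_empty (n : ℕ) : lcmCount n ∅ = 1 := by
  have h1 := lcmCount_pos (n := n) (V := ∅) (by simp)
  have h2 : lcmCount n ∅ ≤ 1 := by
    rw [lcmCount]
    refine (Set.ncard_le_one_iff_eq).2 (Or.inr ⟨1, ?_⟩)
    ext π
    simp [Subsingleton.elim π 1, relPerms]
  omega

theorem lcmCount_eq_subtype (p : ℕ → Prop) [DecidablePred p] :
    (relPerms fun x y : {x : V // p x} => Nat.lcm x y ≤ n).ncard = lcmCount n (V.filter p) := by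
  refine ncard_relPerms_congr _
    ⟨fun x => ⟨x.1.1, Finset.mem_filter.2 ⟨x.1.2, x.2⟩⟩,
      fun y => ⟨⟨y.1, (Finset.mem_filter.1 y.2).1⟩, (Finset.mem_filter.1 y.2).2⟩,
      fun _ => rfl, fun _ => rfl⟩ fun x y => Iff.rfl

theorem lcmCount_mul (p : ℕ → Prop) [DecidablePred p]
    (h : ∀ x ∈ V, ∀ y ∈ V, Nat.lcm x y ≤ n → (p x ↔ p y)) :
    lcmCount n V = lcmCount n (V.filter p) * lcmCount n (V.filter fun x => ¬ p x) := by
  rw [← lcmCount_eq_subtype, ← lcmCount_eq_subtype]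
  exact ncard_relPerms_mul _ (fun x : V => p x) fun x y hxy => h x x.2 y y.2 hxy

theorem filter_ne_lcmCount (v : ℕ) (hv : v ∈ V) :
    (relPerms fun x y : {x : V // x ≠ ⟨v, hv⟩} => Nat.lcm x y ≤ n).ncard =
      lcmCount n (V.erase v) := by
  refine ncard_relPerms_congr _
    ⟨fun x => ⟨x.1.1, Finset.mem_erase.2 ⟨fun h => x.2 (Subtype.ext h), x.1.2⟩⟩,
      fun y => ⟨⟨y.1, (Finset.mem_erase.1 y.2).2⟩,
        fun h => (Finset.mem_erase.1 y.2).1 (congrArg Subtype.val h)⟩,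
      fun _ => rfl, fun _ => rfl⟩ fun x y => Iff.rfl

theorem lcmCount_erase_le (h : ∀ x ∈ V, x ≤ n) (v : ℕ) (hv : v ∈ V) :
    lcmCount n (V.erase v) ≤ lcmCount n V := by
  rw [← filter_ne_lcmCount v hv]
  exact ncard_relPerms_subtype_le (fun x y : V => Nat.lcm x y ≤ n)
    (fun x => by simpa using h x x.2) _

theorem lcmCount_le_erase (h : ∀ x ∈ V, x ≤ n) (v : ℕ) (hv : v ∈ V) (s : Finset ℕ)
    (hs : ∀ x ∈ V, Nat.lcm v x ≤ n → x ∈ s) :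
    lcmCount n V ≤ s.card ^ 2 * (2 * lcmCount n (V.erase v)) := by
  classical
  rw [← filter_ne_lcmCount v hv]
  refine (ncard_relPerms_le _ (fun x => by simpa using h x x.2)
    (fun x y hxy => by rwa [Nat.lcm_comm]) ⟨v, hv⟩
    (V.attach.filter fun x => x.1 ∈ s) (fun x hx => ?_)).trans ?_
  · exact Finset.mem_filter.2 ⟨Finset.mem_attach _ _, hs x x.2 hx⟩
  · gcongr
    refine Finset.card_le_card_of_injOn (fun x => x.1) (fun x hx => ?_)
      (Subtype.val_injective.injOn)
    exact (Finset.mem_filter.1 hx).2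

end LcmCount

/-! ### Increments: their size and their locality. -/

section Increments

/-- The logarithmic increment when the vertex `k` is added to the vertices `k + 1, …, n`. -/
noncomputable def lcmIncr (n k : ℕ) : ℝ :=
  Real.log (lcmCount n (Finset.Icc k n)) - Real.log (lcmCount n (Finset.Icc (k + 1) n))

theorem lcmCount_Icc_pos (n k : ℕ) : 0 < lcmCount n (Finset.Icc k n) :=
  lcmCount_pos fun _ hx => (Finset.mem_Icc.1 hx).2

theorem Icc_erase_left_nat (k n : ℕ) : (Finset.Icc k n).erase k = Finset.Icc (k + 1) n := by
  ext x
  simp only [Finset.mem_erase, Finset.mem_Icc]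
  omega

theorem lcmIncr_nonneg {n k : ℕ} (h : k ≤ n) : 0 ≤ lcmIncr n k := by
  rw [lcmIncr, sub_nonneg]
  apply Real.log_le_log (by exact_mod_cast lcmCount_Icc_pos n (k + 1))
  rw [← Icc_erase_left_nat]
  exact_mod_cast lcmCount_erase_le (fun _ hx => (Finset.mem_Icc.1 hx).2) k
    (Finset.mem_Icc.2 ⟨le_rfl, h⟩)

/-- A neighbour x ≥ k of k satisfies lcm(k, x) = k a = x b with a, b ≤ M = ⌊n/k⌋, and is determined
by (a, b). So the degree is at most M², and the factor 2 deg² is at most 2 M⁴. -/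
theorem lcmIncr_le {n k : ℕ} (hk : 1 ≤ k) (h : k ≤ n) :
    lcmIncr n k ≤ Real.log 2 + 4 * Real.log (n / k : ℕ) := by
  have hM : 1 ≤ n / k := (Nat.one_le_div_iff hk).2 h
  set M := n / k with hMdef
  set s : Finset ℕ := (Finset.Icc 1 M ×ˢ Finset.Icc 1 M).image fun q => k * q.1 / q.2 with hs
  have hcard : s.card ≤ M ^ 2 := by
    refine Finset.card_image_le.trans ?_
    simp [pow_two]
  have h1 := lcmCount_le_erase (n := n) (V := Finset.Icc k n)
    (fun _ hx => (Finset.mem_Icc.1 hx).2) k (Finset.mem_Icc.2 ⟨le_rfl, h⟩) s (by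
      intro x hx hlcm
      obtain ⟨hkx, hxn⟩ := Finset.mem_Icc.1 hx
      obtain ⟨a, ha⟩ := Nat.dvd_lcm_left k x
      obtain ⟨b, hb⟩ := Nat.dvd_lcm_right k x
      have hpos : 0 < Nat.lcm k x := Nat.lcm_pos (by omega) (by omega)
      have ha0 : 1 ≤ a := by
        rcases Nat.eq_zero_or_pos a with rfl | h; · omega
        exact h
      have hb0 : 1 ≤ b := by
        rcases Nat.eq_zero_or_pos b with rfl | h; · omega
        exact h
      refine Finset.mem_image.2 ⟨(a, b), Finset.mem_product.2
        ⟨Finset.mem_Icc.2 ⟨ha0, ?_⟩, Finset.mem_Icc.2 ⟨hb0, ?_⟩⟩, ?_⟩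
      · rw [hMdef, Nat.le_div_iff_mul_le (by omega), mul_comm]
        exact ha ▸ hlcm
      · rw [hMdef, Nat.le_div_iff_mul_le (by omega)]
        calc b * k ≤ b * x := by gcongr
          _ ≤ n := by rw [mul_comm]; omega
      · simp only
        rw [← ha, hb, Nat.mul_div_cancel _ hb0])
  rw [Icc_erase_left_nat] at h1
  have h2 : lcmCount n (Finset.Icc k n) ≤
      M ^ 4 * 2 * lcmCount n (Finset.Icc (k + 1) n) := by
    refine h1.trans ?_
    rw [← mul_assoc]
    have : s.card ^ 2 ≤ M ^ 4 := calc
      s.card ^ 2 ≤ (M ^ 2) ^ 2 := by gcongr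
      _ = M ^ 4 := by ring
    gcongr
  have hp1 : (0 : ℝ) < lcmCount n (Finset.Icc k n) := by exact_mod_cast lcmCount_Icc_pos n k
  have hp2 : (0 : ℝ) < lcmCount n (Finset.Icc (k + 1) n) := by
    exact_mod_cast lcmCount_Icc_pos n (k + 1)
  have hMR : (0 : ℝ) < (M : ℝ) := by exact_mod_cast hM
  have h3 := Real.log_le_log hp1 (show ((lcmCount n (Finset.Icc k n) : ℕ) : ℝ) ≤
    (M : ℝ) ^ 4 * 2 * lcmCount n (Finset.Icc (k + 1) n) by exact_mod_cast h2)
  rw [Real.log_mul (by positivity) hp2.ne', Real.log_mul (by positivity) two_ne_zero,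
    Real.log_pow] at h3
  rw [lcmIncr]
  push_cast at h3
  linarith

theorem log_ncard_Slcm (n : ℕ) :
    Real.log (Slcm n).ncard = ∑ k ∈ Finset.Icc 1 n, lcmIncr n k := by
  rw [ncard_Slcm]
  have h : ∑ k ∈ Finset.Icc 1 n, lcmIncr n k = ∑ i ∈ Finset.range n, lcmIncr n (i + 1) := by
    rw [Finset.range_eq_Ico, Finset.sum_Ico_add' (fun k => lcmIncr n k) 0 n 1]
    rfl
  rw [h]
  unfold lcmIncr
  rw [Finset.sum_range_sub' (fun i => Real.log (lcmCount n (Finset.Icc (i + 1) n)))]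
  simp [lcmCount_empty]

theorem lcmCount_image_mul {n r : ℕ} (hr : 0 < r) (V : Finset ℕ) :
    lcmCount n (V.image (r * ·)) = lcmCount (n / r) V := by
  symm
  have hbij : Function.Bijective
      (fun x : V => (⟨r * x, Finset.mem_image_of_mem _ x.2⟩ : V.image (r * ·))) := by
    constructor
    · intro x y hxy
      have := congrArg Subtype.val hxy
      exact Subtype.ext (Nat.eq_of_mul_eq_mul_left hr this)
    · rintro ⟨y, hy⟩
      obtain ⟨x, hx, rfl⟩ := Finset.mem_image.1 hy
      exact ⟨⟨x, hx⟩, rfl⟩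
  refine ncard_relPerms_congr _ (Equiv.ofBijective _ hbij) ?_
  · intro x y
    rw [Equiv.ofBijective_apply, Equiv.ofBijective_apply]
    rw [Nat.lcm_mul_left, Nat.le_div_iff_mul_le hr, mul_comm]

theorem filter_dvd_Icc_mul {r : ℕ} (hr : 0 < r) (s n : ℕ) :
    (Finset.Icc (s * r) n).filter (r ∣ ·) = (Finset.Icc s (n / r)).image (r * ·) := by
  ext x
  simp only [Finset.mem_filter, Finset.mem_Icc, Finset.mem_image]
  constructor
  · rintro ⟨⟨h1, h2⟩, y, rfl⟩
    refine ⟨y, ⟨?_, ?_⟩, rfl⟩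
    · rw [mul_comm r] at h1; exact Nat.le_of_mul_le_mul_right h1 hr
    · rw [Nat.le_div_iff_mul_le hr, mul_comm]; exact h2
  · rintro ⟨y, ⟨h1, h2⟩, rfl⟩
    rw [Nat.le_div_iff_mul_le hr] at h2
    exact ⟨⟨by rw [mul_comm r]; gcongr, by rwa [mul_comm]⟩, dvd_mul_right _ _⟩

theorem filter_dvd_Icc_mul_succ {r : ℕ} (hr : 0 < r) (s n : ℕ) :
    (Finset.Icc (s * r + 1) n).filter (r ∣ ·) = (Finset.Icc (s + 1) (n / r)).image (r * ·) := by
  rw [← filter_dvd_Icc_mul hr]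
  ext x
  simp only [Finset.mem_filter, Finset.mem_Icc]
  constructor
  · rintro ⟨⟨h1, h2⟩, y, rfl⟩
    refine ⟨⟨?_, h2⟩, dvd_mul_right _ _⟩
    rw [mul_comm]
    gcongr
    by_contra! hlt
    have : r * y ≤ s * r := by rw [mul_comm s]; gcongr; omega
    omega
  · rintro ⟨⟨h1, h2⟩, h3⟩
    exact ⟨⟨by rw [add_mul] at h1; omega, h2⟩, h3⟩

/-- Only the small prime factors of `k = s * r` influence the increment at `k`. -/
theorem lcmIncr_mul {n s r : ℕ} (hs : 0 < s) (hr : 0 < r)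
    (hrough : ∀ p, p.Prime → p ≤ n / (s * r) → ¬ p ∣ r) :
    lcmIncr n (s * r) = lcmIncr (n / r) s := by
  have hk : 0 < s * r := Nat.mul_pos hs hr
  have hdvd : ∀ x y, s * r ≤ x → s * r ≤ y → Nat.lcm x y ≤ n → r ∣ x → r ∣ y := by
    intro x y hx hy hxy hrx
    obtain ⟨b, hb⟩ := Nat.dvd_lcm_right x y
    have hpos : 0 < Nat.lcm x y := Nat.lcm_pos (by omega) (by omega)
    have hb0 : b ≠ 0 := by rintro rfl; omega
    -- The cofactor b = lcm(x, y)/y is at most n/(s r) because y ≥ s r, so its prime factors are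
    -- among those excluded from r.
    have hcop : Nat.Coprime r b := by
      refine Nat.coprime_of_dvd fun p hp hpr hpb => ?_
      refine hrough p hp ((Nat.le_of_dvd (Nat.pos_of_ne_zero hb0) hpb).trans ?_) hpr
      rw [Nat.le_div_iff_mul_le hk]
      calc b * (s * r) ≤ b * y := by gcongr
        _ ≤ n := by rw [mul_comm]; omega
    exact hcop.dvd_of_dvd_mul_right (hb ▸ hrx.trans (Nat.dvd_lcm_left x y))
  have key : ∀ m, s * r ≤ m → lcmCount n (Finset.Icc m n) =
      lcmCount n ((Finset.Icc m n).filter (r ∣ ·)) *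
        lcmCount n ((Finset.Icc m n).filter fun x => ¬ r ∣ x) := by
    intro m hm
    refine lcmCount_mul _ fun x hx y hy hxy => ?_
    have hx := (Finset.mem_Icc.1 hx).1
    have hy := (Finset.mem_Icc.1 hy).1
    exact ⟨hdvd x y (by omega) (by omega) hxy,
      hdvd y x (by omega) (by omega) (by rwa [Nat.lcm_comm])⟩
  -- The new vertex s r is a multiple of r, so the factor coming from the non-multiples is unchanged
  -- and cancels in the increment.
  have hQ : (Finset.Icc (s * r) n).filter (fun x => ¬ r ∣ x) =
      (Finset.Icc (s * r + 1) n).filter fun x => ¬ r ∣ x := by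
    ext x
    simp only [Finset.mem_filter, Finset.mem_Icc]
    constructor
    · rintro ⟨⟨h1, h2⟩, h3⟩
      refine ⟨⟨lt_of_le_of_ne h1 ?_, h2⟩, h3⟩
      rintro rfl
      exact h3 (dvd_mul_left _ _)
    · rintro ⟨⟨h1, h2⟩, h3⟩
      exact ⟨⟨by omega, h2⟩, h3⟩
  rw [lcmIncr, lcmIncr, key _ le_rfl, key _ (Nat.le_succ _), hQ, filter_dvd_Icc_mul hr,
    filter_dvd_Icc_mul_succ hr, lcmCount_image_mul hr, lcmCount_image_mul hr]
  have hq : (0 : ℝ) < lcmCount n ((Finset.Icc (s * r + 1) n).filter fun x => ¬ r ∣ x) := by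
    exact_mod_cast lcmCount_pos fun x hx => (Finset.mem_Icc.1 (Finset.mem_filter.1 hx).1).2
  have h1 : (0 : ℝ) < lcmCount (n / r) (Finset.Icc s (n / r)) := by
    exact_mod_cast lcmCount_Icc_pos _ _
  have h2 : (0 : ℝ) < lcmCount (n / r) (Finset.Icc (s + 1) (n / r)) := by
    exact_mod_cast lcmCount_Icc_pos _ _
  push_cast
  rw [Real.log_mul h1.ne' hq.ne', Real.log_mul h2.ne' hq.ne']
  ring

end Increments

/-! ### Brun's pure sieve. -/

section BrunSieve

open Finset

/-- Bonferroni's inequality for the truncated alternating sum over subsets. -/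
theorem abs_sub_truncated_alternating_sum_le {β : Type*} [DecidableEq β] (w : Finset β) (B : ℕ) :
    |(if w = ∅ then (1 : ℝ) else 0) - ∑ T ∈ w.powerset with #T < B, (-1 : ℝ) ^ #T| ≤
      #{T ∈ w.powerset | #T = B} := by
  have h1 : ∑ T ∈ w.powerset with #T < B, (-1 : ℝ) ^ #T =
      ∑ m ∈ range B, (-1 : ℝ) ^ m * (#w).choose m := by
    rw [← sum_fiberwise_of_maps_to (t := range B) (g := fun T : Finset β => #T)
      (fun T hT => mem_range.2 (mem_filter.1 hT).2)]
    refine sum_congr rfl fun m hm => ?_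
    rw [filter_filter]
    have : (w.powerset.filter fun T => #T < B ∧ #T = m) = w.powersetCard m := by
      ext T
      simp only [mem_filter, mem_powerset, mem_powersetCard]
      have := mem_range.1 hm
      constructor
      · rintro ⟨h, -, h'⟩; exact ⟨h, h'⟩
      · rintro ⟨h, h'⟩; exact ⟨h, by omega, h'⟩
    rw [this, sum_congr rfl fun T hT => by rw [(mem_powersetCard.1 hT).2], sum_const,
      card_powersetCard, nsmul_eq_mul, mul_comm]
  have h2 : (#{T ∈ w.powerset | #T = B} : ℝ) = (#w).choose B := by
    rw [← card_powersetCard, powersetCard_eq_filter]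
  rw [h1, h2]
  rcases w.eq_empty_or_nonempty with rfl | hw
  · rw [if_pos rfl, card_empty]
    cases B with
    | zero => simp
    | succ B => rw [sum_range_succ']; simp
  · rw [if_neg hw.ne_empty]
    cases B with
    | zero => simp
    | succ B =>
      obtain ⟨k, hk⟩ : ∃ k, #w = k + 1 := ⟨#w - 1, by have := hw.card_pos; omega⟩
      rw [hk]
      -- The truncated sum collapses to ±C(k, B), and Pascal's rule gives C(k, B) ≤ C(k+1, B+1).
      have h3 := Int.alternating_sum_range_choose_eq_choose (n := k) (m := B)
      have h4 : ∑ m ∈ range (B + 1), (-1 : ℝ) ^ m * (k + 1).choose m =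
          (-1) ^ B * k.choose B := by exact_mod_cast h3
      rw [h4, zero_sub, abs_neg, abs_mul, abs_pow, abs_neg, abs_one, one_pow, one_mul,
        Nat.abs_cast, Nat.choose_succ_succ]
      push_cast
      linarith [Nat.cast_nonneg (α := ℝ) (k.choose (B + 1))]

/-- The integers `r` with `n / r = t`. -/
def quotFiber (n t : ℕ) : Finset ℕ := Ioc (n / (t + 1)) (n / t)

theorem mem_quotFiber {n t r : ℕ} (ht : 0 < t) : r ∈ quotFiber n t ↔ 0 < r ∧ n / r = t := by
  rw [quotFiber, mem_Ioc, Nat.div_lt_iff_lt_mul (by omega), Nat.le_div_iff_mul_le ht]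
  constructor
  · rintro ⟨h1, h2⟩
    have hr : 0 < r := Nat.pos_of_ne_zero (by rintro rfl; omega)
    refine ⟨hr, (Nat.div_eq_iff hr).2 ⟨by rw [mul_comm]; exact h2, ?_⟩⟩
    have : r * (t + 1) = t * r + r := by ring
    omega
  · rintro ⟨hr, h⟩
    rw [Nat.div_eq_iff hr] at h
    have : r * (t + 1) = t * r + r := by ring
    exact ⟨by omega, by rw [mul_comm]; exact h.1⟩

/-- The count is a difference of two floors, and n/(t(t+1)) = n/t - n/(t+1). Both rounding errors
lie in [0, 1], so their difference is at most 1 in absolute value. -/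
theorem card_filter_dvd_quotFiber (n t d : ℕ) (ht : 0 < t) (hd : 0 < d) :
    |(#{r ∈ quotFiber n t | d ∣ r} : ℝ) - (n : ℝ) / (t * (t + 1)) / d| ≤ 1 := by
  have hle : n / (t + 1) ≤ n / t := Nat.div_le_div_left (Nat.le_succ t) ht
  have h1 : #{r ∈ quotFiber n t | d ∣ r} + n / (t + 1) / d = n / t / d := by
    rw [← Nat.Ioc_filter_dvd_card_eq_div (n / (t + 1)), ← Nat.Ioc_filter_dvd_card_eq_div (n / t),
      quotFiber,
      add_comm, ← card_union_of_disjoint, ← filter_union, Ioc_union_Ioc_eq_Ioc (Nat.zero_le _) hle]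
    exact disjoint_filter_filter (Ioc_disjoint_Ioc_of_le le_rfl)
  have h2 : (#{r ∈ quotFiber n t | d ∣ r} : ℝ) =
      (n / t / d : ℕ) - (n / (t + 1) / d : ℕ) := by
    rw [← h1]; push_cast; ring
  have htR : (0 : ℝ) < t := by exact_mod_cast ht
  have hdR : (0 : ℝ) < d := by exact_mod_cast hd
  have bound : ∀ m : ℕ, 0 < m → ((n / m : ℕ) : ℝ) ≤ (n : ℝ) / m ∧
      (n : ℝ) / m - 1 ≤ ((n / m : ℕ) : ℝ) := by
    intro m hm
    refine ⟨Nat.cast_div_le, ?_⟩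
    have hmR : (0 : ℝ) < m := by exact_mod_cast hm
    rw [sub_le_iff_le_add, div_le_iff₀ hmR]
    have := Nat.lt_div_mul_add hm (a := n)
    have : (n : ℝ) < (n / m : ℕ) * m + m := by exact_mod_cast this
    linarith
  rw [h2, Nat.div_div_eq_div_mul, Nat.div_div_eq_div_mul]
  obtain ⟨a1, a2⟩ := bound (t * d) (by positivity)
  obtain ⟨b1, b2⟩ := bound ((t + 1) * d) (by positivity)
  have e : (n : ℝ) / (t * (t + 1)) / d = (n : ℝ) / (t * d : ℕ) - n / ((t + 1) * d : ℕ) := by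
    push_cast; field_simp; ring
  rw [e, abs_le]
  constructor <;> linarith

theorem prod_primes_dvd_iff {T : Finset ℕ} (hT : ∀ p ∈ T, p.Prime) (r : ℕ) :
    ∏ p ∈ T, p ∣ r ↔ ∀ p ∈ T, p ∣ r :=
  ⟨fun h _ hp => (dvd_prod_of_mem _ hp).trans h,
    fun h => Finset.prod_primes_dvd r (fun _ hp => (hT _ hp).prime) h⟩

/-- Brun's pure sieve for the integers `r` with `n / r = t`. -/
theorem brun_sieve (P : Finset ℕ) (hP : ∀ p ∈ P, p.Prime) (n t B : ℕ) (ht : 0 < t) :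
    |(#{r ∈ quotFiber n t | ∀ p ∈ P, ¬ p ∣ r} : ℝ) -
        (n : ℝ) / (t * (t + 1)) * ∏ p ∈ P, (1 - 1 / (p : ℝ))| ≤
      #{T ∈ P.powerset | #T ≤ B} +
        2 * ((n : ℝ) / (t * (t + 1))) * ∑ T ∈ P.powerset with B ≤ #T, ∏ p ∈ T, 1 / (p : ℝ) := by
  set y : ℝ := (n : ℝ) / (t * (t + 1)) with hy
  have hy0 : 0 ≤ y := by positivity
  set I := quotFiber n t with hI
  let w : ℕ → Finset ℕ := fun r => P.filter (· ∣ r)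
  let N : Finset ℕ → ℝ := fun T => #{r ∈ I | ∏ p ∈ T, p ∣ r}
  let g : Finset ℕ → ℝ := fun T => ∏ p ∈ T, 1 / (p : ℝ)
  have hTP : ∀ T ∈ P.powerset, ∀ p ∈ T, p.Prime := fun T hT p hp => hP p (mem_powerset.1 hT hp)
  have hN : ∀ T ∈ P.powerset, |N T - y * g T| ≤ 1 := by
    intro T hT
    have h := card_filter_dvd_quotFiber n t (∏ p ∈ T, p) ht
      (prod_pos fun p hp => (hTP T hT p hp).pos)
    have : y * g T = y / ((∏ p ∈ T, p : ℕ) : ℝ) := by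
      simp only [g]
      rw [prod_div_distrib, prod_const_one]; push_cast; ring
    rw [this]; exact h
  have hg0 : ∀ T, 0 ≤ g T := fun T => prod_nonneg fun p _ => by positivity
  have hcount : (#{r ∈ I | ∀ p ∈ P, ¬ p ∣ r} : ℝ) = ∑ r ∈ I, if w r = ∅ then (1 : ℝ) else 0 := by
    rw [sum_boole]
    congr 3
    ext r
    simp only [w, filter_eq_empty_iff]
  have hsub : ∀ r, ∀ Q : ℕ → Prop, ∀ [DecidablePred Q],
      ((w r).powerset.filter fun T => Q #T) =
        (P.powerset.filter fun T => Q #T).filter fun T => ∏ p ∈ T, p ∣ r := by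
    intro r Q _
    ext T
    simp only [mem_filter, mem_powerset, w, subset_iff, mem_filter]
    constructor
    · rintro ⟨h1, h2⟩
      exact ⟨⟨fun p hp => (h1 hp).1, h2⟩, (prod_primes_dvd_iff (fun p hp => hP p (h1 hp).1) r).2
        fun p hp => (h1 hp).2⟩
    · rintro ⟨⟨h1, h2⟩, h3⟩
      exact ⟨fun p hp => ⟨h1 hp, (prod_primes_dvd_iff (fun p hp => hP p (h1 hp)) r).1 h3 p hp⟩, h2⟩
  have hswap : ∀ (Q : ℕ → Prop) [DecidablePred Q] (f : Finset ℕ → ℝ),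
      ∑ r ∈ I, ∑ T ∈ (w r).powerset with Q #T, f T =
        ∑ T ∈ P.powerset with Q #T, f T * N T := by
    intro Q _ f
    simp_rw [hsub _ Q, sum_filter (fun T => ∏ p ∈ T, p ∣ _)]
    rw [sum_comm]
    refine sum_congr rfl fun T _ => ?_
    rw [← sum_filter, sum_const, nsmul_eq_mul, mul_comm]
  -- Truncation error: Bonferroni for each r, summed over r.
  have hE1 : |(#{r ∈ I | ∀ p ∈ P, ¬ p ∣ r} : ℝ) -
      ∑ T ∈ P.powerset with #T < B, (-1 : ℝ) ^ #T * N T| ≤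
        ∑ T ∈ P.powerset with #T = B, N T := by
    rw [hcount, ← hswap (fun k => k < B) (fun T => (-1) ^ #T), ← sum_sub_distrib]
    refine (abs_sum_le_sum_abs _ _).trans ?_
    have : ∑ T ∈ P.powerset with #T = B, N T =
        ∑ r ∈ I, ∑ T ∈ (w r).powerset with #T = B, (1 : ℝ) := by
      rw [hswap (fun k => k = B) (fun _ => 1)]; simp
    rw [this]
    refine sum_le_sum fun r _ => ?_
    refine (abs_sub_truncated_alternating_sum_le (w r) B).trans ?_
    simp
  have hW : ∏ p ∈ P, (1 - 1 / (p : ℝ)) = ∑ T ∈ P.powerset, (-1 : ℝ) ^ #T * g T := by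
    simp_rw [sub_eq_add_neg]
    rw [prod_one_add]
    refine sum_congr rfl fun T _ => ?_
    rw [prod_neg, ]
  -- Rounding error: at most 1 for each retained T.
  have hE2 : |∑ T ∈ P.powerset with #T < B, (-1 : ℝ) ^ #T * N T -
      ∑ T ∈ P.powerset with #T < B, (-1 : ℝ) ^ #T * (y * g T)| ≤
        #{T ∈ P.powerset | #T < B} := by
    rw [← sum_sub_distrib]
    refine (abs_sum_le_sum_abs _ _).trans ?_
    rw [card_eq_sum_ones]
    push_cast
    refine sum_le_sum fun T hT => ?_
    rw [← mul_sub, abs_mul, abs_pow, abs_neg, abs_one, one_pow, one_mul]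
    exact hN T (mem_filter.1 hT).1
  -- Completion error: the terms with `B ≤ #T` needed to restore the full product.
  have hE3 : |∑ T ∈ P.powerset with #T < B, (-1 : ℝ) ^ #T * (y * g T) -
      y * ∏ p ∈ P, (1 - 1 / (p : ℝ))| ≤ y * ∑ T ∈ P.powerset with B ≤ #T, g T := by
    have : y * ∏ p ∈ P, (1 - 1 / (p : ℝ)) =
        ∑ T ∈ P.powerset with #T < B, (-1 : ℝ) ^ #T * (y * g T) +
          ∑ T ∈ P.powerset with B ≤ #T, (-1 : ℝ) ^ #T * (y * g T) := by
      rw [hW, mul_sum, ← sum_filter_add_sum_filter_not P.powerset (fun T => #T < B)]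
      simp_rw [not_lt]
      congr 1 <;> exact sum_congr rfl fun T _ => by ring
    rw [this, sub_add_cancel_left, abs_neg, mul_sum]
    refine (abs_sum_le_sum_abs _ _).trans (sum_le_sum fun T _ => ?_)
    rw [abs_mul, abs_pow, abs_neg, abs_one, one_pow, one_mul, abs_of_nonneg
      (mul_nonneg hy0 (hg0 T))]
  have hE4 : ∑ T ∈ P.powerset with #T = B, N T ≤
      #{T ∈ P.powerset | #T = B} + y * ∑ T ∈ P.powerset with B ≤ #T, g T := by
    have h5 : ∑ T ∈ P.powerset with #T = B, N T ≤
        ∑ T ∈ P.powerset with #T = B, (1 + y * g T) :=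
      sum_le_sum fun T hT => by
        have := (abs_le.1 (hN T (mem_filter.1 hT).1)).2
        linarith
    refine h5.trans ?_
    rw [sum_add_distrib, ← mul_sum]
    have h6 : ∑ T ∈ P.powerset with #T = B, g T ≤ ∑ T ∈ P.powerset with B ≤ #T, g T :=
      sum_le_sum_of_subset_of_nonneg (fun T hT => by
        simp only [mem_filter] at hT ⊢; exact ⟨hT.1, hT.2.ge⟩) fun T _ _ => hg0 T
    have := mul_le_mul_of_nonneg_left h6 hy0
    simp only [sum_const, nsmul_eq_mul, mul_one]
    linarith
  have hcard : (#{T ∈ P.powerset | #T ≤ B} : ℝ) =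
      #{T ∈ P.powerset | #T < B} + #{T ∈ P.powerset | #T = B} := by
    rw [← Nat.cast_add, ← card_union_of_disjoint, ← filter_or]
    · simp_rw [le_iff_lt_or_eq]
    · exact disjoint_filter.2 fun T _ h1 h2 => by omega
  have := abs_sub_le (#{r ∈ I | ∀ p ∈ P, ¬ p ∣ r} : ℝ)
    (∑ T ∈ P.powerset with #T < B, (-1 : ℝ) ^ #T * N T) (y * ∏ p ∈ P, (1 - 1 / (p : ℝ)))
  have h7 := abs_sub_le (∑ T ∈ P.powerset with #T < B, (-1 : ℝ) ^ #T * N T)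
    (∑ T ∈ P.powerset with #T < B, (-1 : ℝ) ^ #T * (y * g T)) (y * ∏ p ∈ P, (1 - 1 / (p : ℝ)))
  rw [hcard]
  linarith

/-- By unique factorization a set of primes is determined by its product, which is at most q^B here.
-/
theorem card_powerset_card_le (P : Finset ℕ) (hP : ∀ p ∈ P, p.Prime) {q : ℕ} (hq : 1 ≤ q)
    (hPq : ∀ p ∈ P, p ≤ q) (B : ℕ) : #{T ∈ P.powerset | #T ≤ B} ≤ q ^ B := by
  have : #{T ∈ P.powerset | #T ≤ B} ≤ #(Icc 1 (q ^ B)) := by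
    refine card_le_card_of_injOn (fun T => ∏ p ∈ T, p) ?_ ?_
    · intro T hT
      simp only [coe_filter, mem_powerset, Set.mem_ofPred_eq] at hT
      refine mem_Icc.2 ⟨prod_pos fun p hp => (hP p (hT.1 hp)).pos, ?_⟩
      refine (prod_le_pow_card T _ q fun p hp => hPq p (hT.1 hp)).trans ?_
      exact Nat.pow_le_pow_right hq hT.2
    · intro T hT T' hT' h
      simp only [coe_filter, mem_powerset, Set.mem_ofPred_eq] at hT hT'
      simp only at h
      rw [← Nat.primeFactors_prod fun p hp => hP p (hT.1 hp), h,
        Nat.primeFactors_prod fun p hp => hP p (hT'.1 hp)]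
  simpa using this

/-- Rankin's trick: each term with `B ≤ #T` may be weighted by z^(#T - B) ≥ 1, after which the sum
over all T factors. -/
theorem sum_powerset_card_ge_le (P : Finset ℕ) {z : ℝ} (hz : 1 ≤ z) (B : ℕ) :
    ∑ T ∈ P.powerset with B ≤ #T, ∏ p ∈ T, 1 / (p : ℝ) ≤
      z⁻¹ ^ B * ∏ p ∈ P, (1 + z / p) := by
  have hz0 : 0 < z := by linarith
  rw [prod_one_add, mul_sum]
  refine (sum_le_sum (g := fun T : Finset ℕ => z⁻¹ ^ B * ∏ p ∈ T, z / (p : ℝ)) fun T hT => ?_).trans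
    (sum_le_sum_of_subset_of_nonneg (filter_subset (fun T => B ≤ #T) _) fun T _ _ => ?_)
  · have h1 : ∏ p ∈ T, z / (p : ℝ) = z ^ #T * ∏ p ∈ T, 1 / (p : ℝ) := by
      rw [← prod_const, ← prod_mul_distrib]
      exact prod_congr rfl fun p _ => by ring
    rw [h1, ← mul_assoc]
    refine le_mul_of_one_le_left (prod_nonneg fun p _ => by positivity) ?_
    rw [inv_pow, inv_mul_eq_div, one_le_div (by positivity)]
    exact pow_le_pow_right₀ hz (mem_filter.1 hT).2
  · exact mul_nonneg (by positivity) (prod_nonneg fun p _ => by positivity)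

end BrunSieve

/-! ### Smooth parts and Rankin's bound. -/

section SmoothPart

open Finset

/-- The largest divisor of `k` composed of primes below `q`. -/
def smoothPart (q k : ℕ) : ℕ := (k.primeFactorsList.filter fun p => p < q).prod

theorem smoothPart_mul_roughPart (q : ℕ) {k : ℕ} (hk : k ≠ 0) :
    smoothPart q k * (k.primeFactorsList.filter fun p => ¬ p < q).prod = k := by
  have h := List.prod_map_filter_mul_prod_map_filter_not (fun p : ℕ => p < q) id
    k.primeFactorsList
  simpa [smoothPart, Nat.prod_primeFactorsList hk] using h

theorem smoothPart_dvd (q : ℕ) {k : ℕ} (hk : k ≠ 0) : smoothPart q k ∣ k :=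
  ⟨_, (smoothPart_mul_roughPart q hk).symm⟩

theorem smoothPart_pos (q : ℕ) {k : ℕ} (hk : k ≠ 0) : 0 < smoothPart q k :=
  Nat.pos_of_ne_zero fun h => hk (by have := smoothPart_mul_roughPart q hk; rw [h] at this; omega)

theorem smoothPart_mem (q k : ℕ) : smoothPart q k ∈ Nat.smoothNumbers q := by
  rw [Nat.mem_smoothNumbers']
  intro p hp hpd
  obtain ⟨x, hx, hpx⟩ := (Nat.Prime.prime hp).dvd_prod_iff.1 hpd
  obtain ⟨h1, h2⟩ := List.mem_filter.1 hx
  rw [(Nat.prime_dvd_prime_iff_eq hp (Nat.prime_of_mem_primeFactorsList h1)).1 hpx]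
  simpa using h2

theorem not_dvd_div_smoothPart (q : ℕ) {k : ℕ} (hk : k ≠ 0) {p : ℕ} (hp : p.Prime) (hpq : p < q) :
    ¬ p ∣ k / smoothPart q k := by
  have h : k / smoothPart q k = (k.primeFactorsList.filter fun p => ¬ p < q).prod :=
    Nat.div_eq_of_eq_mul_right (smoothPart_pos q hk) (smoothPart_mul_roughPart q hk).symm
  rw [h]
  intro hpd
  obtain ⟨x, hx, hpx⟩ := (Nat.Prime.prime hp).dvd_prod_iff.1 hpd
  obtain ⟨h1, h2⟩ := List.mem_filter.1 hx
  rw [(Nat.prime_dvd_prime_iff_eq hp (Nat.prime_of_mem_primeFactorsList h1)).1 hpx] at hpq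
  simp only [decide_eq_true_eq] at h2
  exact h2 hpq

theorem smoothPart_mul {q s r : ℕ} (hs : s ∈ Nat.smoothNumbers q) (hr : r ≠ 0)
    (hrough : ∀ p, p.Prime → p < q → ¬ p ∣ r) : smoothPart q (s * r) = s := by
  have hs0 := Nat.ne_zero_of_mem_smoothNumbers hs
  unfold smoothPart
  rw [((Nat.perm_primeFactorsList_mul hs0 hr).filter _).prod_eq, List.filter_append,
    List.prod_append]
  have h1 : (s.primeFactorsList.filter fun p => p < q) = s.primeFactorsList := by
    rw [List.filter_eq_self]
    intro p hp
    simpa using hs.2 p hp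
  have h2 : (r.primeFactorsList.filter fun p => p < q) = [] := by
    rw [List.filter_eq_nil_iff]
    intro p hp
    have := hrough p (Nat.prime_of_mem_primeFactorsList hp)
    simp only [decide_eq_true_eq]
    exact fun h => this h (Nat.dvd_of_mem_primeFactorsList hp)
  rw [h1, h2, Nat.prod_primeFactorsList hs0, List.prod_nil, mul_one]

/-- The sum of the reciprocals of the primes below `q`. -/
noncomputable def primeRecipSum (q : ℕ) : ℝ := ∑ p ∈ q.primesBelow, 1 / (p : ℝ)

/-- Rankin's bound for sums over smooth numbers. -/
theorem sum_smooth_rpow_le (q : ℕ) {θ : ℝ} (h0 : 0 < θ) (h1 : θ ≤ 1 / 2) (U : Finset ℕ)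
    (hU : ∀ s ∈ U, s ∈ Nat.smoothNumbers q) :
    ∑ s ∈ U, (s : ℝ) ^ (θ - 1) ≤ Real.exp (4 * (q : ℝ) ^ θ * primeRecipSum q) := by
  have hne : θ - 1 ≠ 0 := by linarith
  let f : ℕ →* ℝ :=
    { toFun := fun n => (n : ℝ) ^ (θ - 1)
      map_one' := by simp
      map_mul' := fun a b => by
        push_cast
        exact Real.mul_rpow (Nat.cast_nonneg a) (Nat.cast_nonneg b) }
  have hf : ∀ n : ℕ, f n = (n : ℝ) ^ (θ - 1) := fun _ => rfl
  have hf0 : ∀ n : ℕ, 0 ≤ f n := fun n => by rw [hf]; positivity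
  -- As θ ≤ 1/2, f p is at most 2^(-1/2) ≤ 3/4. Then 1 - f p ≥ 1/4, so each Euler factor is at most
  -- exp(4 f p); this is the origin of the 4 in the bound.
  have hsmall : ∀ p : ℕ, p.Prime → f p ≤ 3 / 4 := by
    intro p hp
    rw [hf]
    have hp2 : (2 : ℝ) ≤ p := by exact_mod_cast hp.two_le
    calc (p : ℝ) ^ (θ - 1) ≤ (p : ℝ) ^ (-(1 / 2) : ℝ) :=
          Real.rpow_le_rpow_of_exponent_le (by linarith) (by linarith)
      _ ≤ (2 : ℝ) ^ (-(1 / 2) : ℝ) :=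
          Real.rpow_le_rpow_of_nonpos (by norm_num) hp2 (by norm_num)
      _ ≤ 3 / 4 := by
          rw [Real.rpow_neg (by norm_num), ← Real.sqrt_eq_rpow, inv_le_comm₀ (by positivity)
            (by norm_num)]
          exact Real.le_sqrt_of_sq_le (by norm_num)
  have hsum := EulerProduct.summable_and_hasSum_smoothNumbers_prod_primesBelow_geometric (f := f)
    (fun {p} hp => by
      rw [Real.norm_of_nonneg (hf0 p)]
      linarith [hsmall p hp]) q
  have h2 : ∑ s ∈ U, (s : ℝ) ^ (θ - 1) ≤ ∏ p ∈ q.primesBelow, (1 - f p)⁻¹ := by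
    let e : U ↪ q.smoothNumbers := ⟨fun s => ⟨s.1, hU s.1 s.2⟩,
      fun a b hab => Subtype.ext (congrArg (fun x : q.smoothNumbers => x.1) hab)⟩
    have h3 := sum_le_hasSum (U.attach.map e) (fun i _ => hf0 i) hsum.2
    rw [sum_map] at h3
    rw [← sum_attach]
    exact h3
  refine h2.trans ?_
  rw [primeRecipSum, mul_sum, Real.exp_sum]
  refine prod_le_prod (fun p hp => ?_) fun p hp => ?_
  · have := hsmall p (Nat.prime_of_mem_primesBelow hp)
    exact inv_nonneg.2 (by linarith)
  · have hpp := Nat.prime_of_mem_primesBelow hp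
    have h4 := hsmall p hpp
    have hp0 : (0 : ℝ) < p := by exact_mod_cast hpp.pos
    have h5 : f p ≤ (q : ℝ) ^ θ * (1 / p) := by
      rw [hf, Real.rpow_sub hp0, Real.rpow_one, div_eq_mul_one_div]
      gcongr
      exact (Nat.lt_of_mem_primesBelow hp).le
    have h6 : (1 - f p)⁻¹ = 1 + f p / (1 - f p) := by
      have : 1 - f p ≠ 0 := by linarith
      field_simp; ring
    have h7 : f p / (1 - f p) ≤ 4 * f p := by
      rw [div_le_iff₀ (by linarith)]
      nlinarith [hf0 p]
    rw [h6]
    calc 1 + f p / (1 - f p) ≤ Real.exp (f p / (1 - f p)) := by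
          rw [add_comm]; exact Real.add_one_le_exp _
      _ ≤ Real.exp (4 * (q : ℝ) ^ θ * (1 / p)) := by
          apply Real.exp_le_exp.2
          nlinarith

theorem prod_one_add_div_le (q : ℕ) {z : ℝ} (hz : 0 ≤ z) :
    ∏ p ∈ q.primesBelow, (1 + z / (p : ℝ)) ≤ Real.exp (z * primeRecipSum q) := by
  rw [primeRecipSum, mul_sum, Real.exp_sum]
  refine prod_le_prod (fun p _ => by positivity) fun p _ => ?_
  rw [add_comm, mul_one_div]
  exact Real.add_one_le_exp _

end SmoothPart

/-! ### One block: sorting vertices by smooth part. -/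

section Block

open Finset

/-- The vertices `k` with `a ≤ n / k < b`. -/
def blockVerts (n a b : ℕ) : Finset ℕ := (Icc 1 n).filter fun k => a * k ≤ n ∧ n < b * k

open Classical in
/-- The `q`-smooth integers in `[1, S]`. -/
noncomputable def smoothUpTo (q S : ℕ) : Finset ℕ := (Icc 1 S).filter (· ∈ Nat.smoothNumbers q)

/-- The number of `r` free of primes below `q` with `n / r = t`. -/
def roughCount (q n t : ℕ) : ℕ := #{r ∈ quotFiber n t | ∀ p ∈ q.primesBelow, ¬ p ∣ r}

noncomputable def roughDensity (q : ℕ) : ℝ := ∏ p ∈ q.primesBelow, (1 - 1 / (p : ℝ))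

/-- The mean contribution of the vertices in a block whose smooth part is at most `S`. -/
noncomputable def blockCenter (a b q S : ℕ) : ℝ :=
  ∑ s ∈ smoothUpTo q S, ∑ t ∈ Ico (s * a) (s * b),
    lcmIncr t s * (1 / ((t : ℝ) * (t + 1)) * roughDensity q)

theorem lcmIncr_le_of_lt {n k b : ℕ} (hk : 1 ≤ k) (h : k ≤ n) (hb : n < b * k) :
    lcmIncr n k ≤ Real.log 2 + 4 * Real.log b := by
  refine (lcmIncr_le hk h).trans ?_
  have h1 : 1 ≤ n / k := (Nat.one_le_div_iff hk).2 h
  have h2 : n / k ≤ b := ((Nat.div_lt_iff_lt_mul hk).2 hb).le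
  have h3 : (0 : ℝ) < (n / k : ℕ) := by exact_mod_cast h1
  gcongr

/-- Write k = s r with r free of primes below q, and t = ⌊n/r⌋. Then a ≤ n/k < b becomes s a ≤ t < s
b, so k corresponds to the pair (t, r). Since b ≤ q, every prime up to n/k is below q, and
`lcmIncr_mul` makes the increment depend on s and t alone. -/
theorem sum_block_smoothPart_eq {n a b q s : ℕ} (ha : 1 ≤ a) (hbq : b ≤ q)
    (hs : s ∈ Nat.smoothNumbers q) :
    ∑ k ∈ blockVerts n a b with smoothPart q k = s, lcmIncr n k =
      ∑ t ∈ Ico (s * a) (s * b), lcmIncr t s * roughCount q n t := by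
  have hs0 : 0 < s := Nat.pos_of_ne_zero (Nat.ne_zero_of_mem_smoothNumbers hs)
  have h1 : ∀ t, lcmIncr t s * roughCount q n t =
      ∑ r ∈ quotFiber n t with ∀ p ∈ q.primesBelow, ¬ p ∣ r, lcmIncr t s := by
    intro t
    rw [sum_const, nsmul_eq_mul, mul_comm, roughCount]
  have hmem : ∀ t r, (t ∈ Ico (s * a) (s * b) ∧
      r ∈ quotFiber n t ∧ ∀ p ∈ q.primesBelow, ¬ p ∣ r) →
      (0 < r ∧ n / r = t ∧ a * (s * r) ≤ n ∧ n < b * (s * r) ∧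
        ∀ p, p.Prime → p < q → ¬ p ∣ r) := by
    rintro t r ⟨ht, hr, hrough⟩
    obtain ⟨ht1, ht2⟩ := mem_Ico.1 ht
    have ht0 : 0 < t := lt_of_lt_of_le (Nat.mul_pos hs0 ha) ht1
    obtain ⟨hr0, rfl⟩ := (mem_quotFiber ht0).1 hr
    refine ⟨hr0, rfl, ?_, ?_, fun p hp hpq => hrough p (Nat.mem_primesBelow.2 ⟨hpq, hp⟩)⟩
    · rw [Nat.le_div_iff_mul_le hr0] at ht1
      calc a * (s * r) = s * a * r := by ring
        _ ≤ n := ht1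
    · rw [Nat.div_lt_iff_lt_mul hr0] at ht2
      calc n < s * b * r := ht2
        _ = b * (s * r) := by ring
  simp_rw [h1]
  rw [sum_sigma']
  symm
  refine sum_nbij' (fun x => s * x.2) (fun k => ⟨n / (k / s), k / s⟩) ?_ ?_ ?_ ?_ ?_
  · rintro ⟨t, r⟩ hx
    simp only [mem_sigma, mem_filter] at hx
    obtain ⟨hr0, -, h2, h3, h4⟩ := hmem t r hx
    simp only [blockVerts, mem_filter, mem_Icc]
    have hpos : 1 ≤ s * r := Nat.mul_pos hs0 hr0
    exact ⟨⟨⟨hpos, le_trans (Nat.le_mul_of_pos_left _ ha) h2⟩, h2, h3⟩,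
      smoothPart_mul hs hr0.ne' h4⟩
  · intro k hk
    simp only [blockVerts, mem_filter, mem_Icc] at hk
    obtain ⟨⟨⟨hk1, hkn⟩, hak, hbk⟩, hsk⟩ := hk
    have hk0 : k ≠ 0 := by omega
    have hsd : s ∣ k := hsk ▸ smoothPart_dvd q hk0
    obtain ⟨r, rfl⟩ := hsd
    have hr0 : 0 < r := Nat.pos_of_ne_zero (by rintro rfl; omega)
    rw [Nat.mul_div_cancel_left _ hs0]
    have ht1 : s * a ≤ n / r := by
      rw [Nat.le_div_iff_mul_le hr0]
      calc s * a * r = a * (s * r) := by ring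
        _ ≤ n := hak
    simp only [mem_sigma, mem_filter, mem_Ico]
    refine ⟨⟨ht1, ?_⟩, (mem_quotFiber (lt_of_lt_of_le (Nat.mul_pos hs0 ha) ht1)).2 ⟨hr0, rfl⟩, ?_⟩
    · rw [Nat.div_lt_iff_lt_mul hr0]
      calc n < b * (s * r) := hbk
        _ = s * b * r := by ring
    · intro p hp
      have := not_dvd_div_smoothPart q hk0 (Nat.prime_of_mem_primesBelow hp)
        (Nat.lt_of_mem_primesBelow hp)
      rwa [hsk, Nat.mul_div_cancel_left _ hs0] at this
  · rintro ⟨t, r⟩ hx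
    simp only [mem_sigma, mem_filter] at hx
    obtain ⟨hr0, h2, -⟩ := hmem t r hx
    simp only [Nat.mul_div_cancel_left _ hs0, h2]
  · intro k hk
    simp only [blockVerts, mem_filter, mem_Icc] at hk
    obtain ⟨⟨⟨hk1, hkn⟩, -⟩, hsk⟩ := hk
    exact Nat.mul_div_cancel' (hsk ▸ smoothPart_dvd q (by omega))
  · rintro ⟨t, r⟩ hx
    simp only [mem_sigma, mem_filter] at hx
    obtain ⟨hr0, h2, h3, h4, h5⟩ := hmem t r hx
    simp only
    rw [lcmIncr_mul hs0 hr0, h2]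
    intro p hp hpn
    refine h5 p hp (lt_of_le_of_lt hpn (lt_of_lt_of_le ?_ hbq))
    rw [Nat.div_lt_iff_lt_mul (Nat.mul_pos hs0 hr0)]
    exact h4

/-- Each such k ≤ n/a is a multiple of a smooth s > S, and 1/s ≤ (S + 1)^(-θ) s^(θ - 1), which
brings in Rankin's bound. -/
theorem card_block_smoothPart_gt_le {n a b q S : ℕ} (ha : 1 ≤ a) {θ : ℝ} (h0 : 0 < θ)
    (h1 : θ ≤ 1 / 2) :
    (#{k ∈ blockVerts n a b | S < smoothPart q k} : ℝ) ≤
      n / a * (((S : ℝ) + 1) ^ (-θ) * Real.exp (4 * (q : ℝ) ^ θ * primeRecipSum q)) := by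
  classical
  set V := (smoothUpTo q (n / a)).filter fun s => S < s with hV
  have hVmem : ∀ s ∈ V, 0 < s ∧ S < s ∧ s ∈ Nat.smoothNumbers q := fun s hs => by
    simp only [hV, smoothUpTo, mem_filter, mem_Icc] at hs
    exact ⟨hs.1.1.1, hs.2, hs.1.2⟩
  have hsub : {k ∈ blockVerts n a b | S < smoothPart q k} ⊆
      V.biUnion fun s => (Ioc 0 (n / a)).filter (s ∣ ·) := by
    intro k hk
    simp only [blockVerts, mem_filter, mem_Icc] at hk
    obtain ⟨⟨⟨hk1, hkn⟩, hak, hbk⟩, hsk⟩ := hk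
    have hk0 : k ≠ 0 := by omega
    have hkna : k ≤ n / a := by rw [Nat.le_div_iff_mul_le ha, mul_comm]; exact hak
    have hd := smoothPart_dvd q hk0
    simp only [mem_biUnion, mem_filter, mem_Ioc, hV, smoothUpTo, mem_Icc]
    exact ⟨smoothPart q k, ⟨⟨⟨smoothPart_pos q hk0, (Nat.le_of_dvd hk1 hd).trans hkna⟩,
      smoothPart_mem q k⟩, hsk⟩, ⟨hk1, hkna⟩, hd⟩
  have h2 : #{k ∈ blockVerts n a b | S < smoothPart q k} ≤ ∑ s ∈ V, n / a / s := by
    refine (card_le_card hsub).trans (card_biUnion_le.trans (le_of_eq ?_))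
    exact sum_congr rfl fun s _ => Nat.Ioc_filter_dvd_card_eq_div _ _
  have hS : (0 : ℝ) < (S : ℝ) + 1 := by positivity
  calc (#{k ∈ blockVerts n a b | S < smoothPart q k} : ℝ)
      ≤ ∑ s ∈ V, ((n / a / s : ℕ) : ℝ) := by exact_mod_cast h2
    _ ≤ ∑ s ∈ V, (n / a * ((S : ℝ) + 1) ^ (-θ)) * (s : ℝ) ^ (θ - 1) := by
        refine sum_le_sum fun s hs => ?_
        obtain ⟨hs0, hsS, -⟩ := hVmem s hs
        have hsR : (0 : ℝ) < s := by exact_mod_cast hs0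
        have h3 : ((n / a / s : ℕ) : ℝ) ≤ n / a / s :=
          Nat.cast_div_le.trans (by gcongr; exact Nat.cast_div_le)
        refine h3.trans ?_
        have h4 : (s : ℝ) ^ (-θ) ≤ ((S : ℝ) + 1) ^ (-θ) :=
          Real.rpow_le_rpow_of_nonpos hS (by exact_mod_cast hsS) (by linarith)
        have h5 : (n : ℝ) / a / s = n / a * ((s : ℝ) ^ (-θ) * (s : ℝ) ^ (θ - 1)) := by
          rw [← Real.rpow_add hsR, show -θ + (θ - 1) = -1 by ring, Real.rpow_neg_one,
            div_eq_mul_inv ((n : ℝ) / a)]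
        rw [h5, mul_assoc]
        gcongr
    _ ≤ n / a * (((S : ℝ) + 1) ^ (-θ) * Real.exp (4 * (q : ℝ) ^ θ * primeRecipSum q)) := by
        rw [← mul_sum, mul_assoc]
        gcongr
        exact sum_smooth_rpow_le q h0 h1 V fun s hs => (hVmem s hs).2.2

/-- Every increment in the block is at most log 2 + 4 log b. So it suffices to count the vertices
with large smooth part and to compare the rough counts with their densities. -/
theorem abs_block_sub_le {n a b q S : ℕ} (ha : 1 ≤ a) (hb : 1 ≤ b) (hbq : b ≤ q) {θ : ℝ}
    (h0 : 0 < θ) (h1 : θ ≤ 1 / 2) :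
    |∑ k ∈ blockVerts n a b, lcmIncr n k - n * blockCenter a b q S| ≤
      (Real.log 2 + 4 * Real.log b) *
        (n / a * (((S : ℝ) + 1) ^ (-θ) * Real.exp (4 * (q : ℝ) ^ θ * primeRecipSum q)) +
          ∑ s ∈ smoothUpTo q S, ∑ t ∈ Ico (s * a) (s * b),
            |(roughCount q n t : ℝ) - n / (t * (t + 1)) * roughDensity q|) := by
  classical
  set A : ℝ := Real.log 2 + 4 * Real.log b with hA
  have hA0 : 0 ≤ A := by
    have : 0 ≤ Real.log b := Real.log_nonneg (by exact_mod_cast hb)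
    have := Real.log_nonneg (show (1 : ℝ) ≤ 2 by norm_num)
    positivity
  have hUmem : ∀ s ∈ smoothUpTo q S, 0 < s ∧ s ∈ Nat.smoothNumbers q := fun s hs => by
    simp only [smoothUpTo, mem_filter, mem_Icc] at hs
    exact ⟨hs.1.1, hs.2⟩
  have hmain : ∑ k ∈ blockVerts n a b with ¬ S < smoothPart q k, lcmIncr n k =
      ∑ s ∈ smoothUpTo q S, ∑ t ∈ Ico (s * a) (s * b), lcmIncr t s * roughCount q n t := by
    rw [← sum_fiberwise_of_maps_to (t := smoothUpTo q S) (g := smoothPart q)]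
    · refine sum_congr rfl fun s hs => ?_
      rw [← sum_block_smoothPart_eq ha hbq (hUmem s hs).2, filter_filter]
      congr 1
      ext k
      simp only [mem_filter, and_congr_right_iff, and_iff_right_iff_imp]
      rintro - rfl
      simp only [smoothUpTo, mem_filter, mem_Icc] at hs
      omega
    · intro k hk
      simp only [blockVerts, mem_filter, mem_Icc] at hk
      have hk0 : k ≠ 0 := by omega
      simp only [smoothUpTo, mem_filter, mem_Icc]
      exact ⟨⟨smoothPart_pos q hk0, by omega⟩, smoothPart_mem q k⟩
  have htail : |∑ k ∈ blockVerts n a b with S < smoothPart q k, lcmIncr n k| ≤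
      A * #{k ∈ blockVerts n a b | S < smoothPart q k} := by
    have hk : ∀ k ∈ {k ∈ blockVerts n a b | S < smoothPart q k},
        0 ≤ lcmIncr n k ∧ lcmIncr n k ≤ A := by
      intro k hk
      simp only [blockVerts, mem_filter, mem_Icc] at hk
      exact ⟨lcmIncr_nonneg hk.1.1.2, lcmIncr_le_of_lt hk.1.1.1 hk.1.1.2 hk.1.2.2⟩
    rw [abs_of_nonneg (sum_nonneg fun k h => (hk k h).1), mul_comm, ← nsmul_eq_mul]
    exact sum_le_card_nsmul _ _ _ fun k h => (hk k h).2
  have hcard := mul_le_mul_of_nonneg_left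
    (card_block_smoothPart_gt_le (n := n) (b := b) (q := q) (S := S) ha h0 h1) hA0
  have hdiff : |∑ s ∈ smoothUpTo q S, ∑ t ∈ Ico (s * a) (s * b), lcmIncr t s * roughCount q n t -
      n * blockCenter a b q S| ≤ A * ∑ s ∈ smoothUpTo q S, ∑ t ∈ Ico (s * a) (s * b),
        |(roughCount q n t : ℝ) - n / (t * (t + 1)) * roughDensity q| := by
    rw [blockCenter, mul_sum, ← sum_sub_distrib, mul_sum]
    refine (abs_sum_le_sum_abs _ _).trans (sum_le_sum fun s hs => ?_)
    rw [mul_sum, ← sum_sub_distrib, mul_sum]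
    refine (abs_sum_le_sum_abs _ _).trans (sum_le_sum fun t ht => ?_)
    have hs0 := (hUmem s hs).1
    obtain ⟨ht1, ht2⟩ := mem_Ico.1 ht
    have hst : s ≤ t := le_trans (Nat.le_mul_of_pos_right _ ha) ht1
    have e : lcmIncr t s * roughCount q n t -
        n * (lcmIncr t s * (1 / ((t : ℝ) * (t + 1)) * roughDensity q)) =
        lcmIncr t s * ((roughCount q n t : ℝ) - n / (t * (t + 1)) * roughDensity q) := by ring
    rw [e, abs_mul, abs_of_nonneg (lcmIncr_nonneg hst)]
    gcongr
    exact lcmIncr_le_of_lt hs0 hst (by rwa [mul_comm])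
  rw [← sum_filter_add_sum_filter_not (blockVerts n a b) (fun k => S < smoothPart q k), hmain,
    mul_add]
  have := abs_add_le (∑ k ∈ blockVerts n a b with S < smoothPart q k, lcmIncr n k)
    (∑ s ∈ smoothUpTo q S, ∑ t ∈ Ico (s * a) (s * b), lcmIncr t s * roughCount q n t -
      n * blockCenter a b q S)
  rw [add_sub_assoc]
  linarith

end Block

/-! ### Dyadic decomposition, and convergence from moving centres. -/

section Decomposition

open Finset

theorem log_two_add_le (i : ℕ) :
    Real.log 2 + 4 * Real.log ((2 ^ (i + 1) : ℕ) : ℝ) ≤ 5 * ((i : ℝ) + 1) := by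
  push_cast
  rw [Real.log_pow]
  have := Real.log_two_lt_d9
  push_cast
  nlinarith [Nat.cast_nonneg (α := ℝ) i]

theorem sum_far_eq (n I : ℕ) :
    ∑ k ∈ Icc 1 n with 2 ^ I * k ≤ n, lcmIncr n k =
      ∑ k ∈ blockVerts n (2 ^ I) (2 ^ (I + 1)), lcmIncr n k +
        ∑ k ∈ Icc 1 n with 2 ^ (I + 1) * k ≤ n, lcmIncr n k := by
  rw [← sum_filter_add_sum_filter_not (filter _ _) (fun k => n < 2 ^ (I + 1) * k), filter_filter,
    filter_filter]
  congr 1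
  refine sum_congr (filter_congr fun k _ => ?_) fun _ _ => rfl
  rw [not_lt, and_iff_right_iff_imp]
  exact fun h => le_trans (Nat.mul_le_mul_right _ (Nat.pow_le_pow_right two_pos (Nat.le_succ I))) h

theorem log_ncard_Slcm_eq_blocks (n I : ℕ) :
    Real.log (Slcm n).ncard =
      ∑ i ∈ range I, ∑ k ∈ blockVerts n (2 ^ i) (2 ^ (i + 1)), lcmIncr n k +
        ∑ k ∈ Icc 1 n with 2 ^ I * k ≤ n, lcmIncr n k := by
  induction I with
  | zero =>
    rw [log_ncard_Slcm, range_zero, sum_empty, zero_add]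
    refine sum_congr (filter_true_of_mem fun k hk => ?_).symm fun _ _ => rfl
    simpa using (mem_Icc.1 hk).2
  | succ I ih => rw [ih, sum_range_succ, sum_far_eq, add_assoc]

theorem sum_far_le (n I : ℕ) :
    ∑ k ∈ Icc 1 n with 2 ^ I * k ≤ n, lcmIncr n k ≤ n * (10 * ((I : ℝ) + 2) / 2 ^ I) := by
  -- Descending induction on I, starting where the sum is empty. The block bound 5(I+1)/2^I and the
  -- remainder 10(I+3)/2^(I+1) add up to exactly 10(I+2)/2^I.
  have hind : ∀ d I : ℕ, n < 2 ^ (I + d) →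
      ∑ k ∈ Icc 1 n with 2 ^ I * k ≤ n, lcmIncr n k ≤ n * (10 * ((I : ℝ) + 2) / 2 ^ I) := by
    intro d
    induction d with
    | zero =>
      intro I h
      rw [filter_false_of_mem, sum_empty]
      · positivity
      · intro k hk
        have h1 := (mem_Icc.1 hk).1
        rw [not_le]
        exact lt_of_lt_of_le h (Nat.le_mul_of_pos_right _ h1)
    | succ d ih =>
      intro I h
      have h1 := ih (I + 1) (by rwa [add_right_comm, add_assoc])
      have h2 : ∑ k ∈ blockVerts n (2 ^ I) (2 ^ (I + 1)), lcmIncr n k ≤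
          n / 2 ^ I * (5 * ((I : ℝ) + 1)) := by
        have h3 : ∀ k ∈ blockVerts n (2 ^ I) (2 ^ (I + 1)), lcmIncr n k ≤ 5 * ((I : ℝ) + 1) := by
          intro k hk
          simp only [blockVerts, mem_filter, mem_Icc] at hk
          exact (lcmIncr_le_of_lt hk.1.1 hk.1.2 hk.2.2).trans (log_two_add_le I)
        have h4 : #(blockVerts n (2 ^ I) (2 ^ (I + 1))) ≤ n / 2 ^ I := by
          refine (card_le_card (t := Icc 1 (n / 2 ^ I)) fun k hk => ?_).trans (by simp)
          simp only [blockVerts, mem_filter, mem_Icc] at hk ⊢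
          exact ⟨hk.1.1, by rw [Nat.le_div_iff_mul_le (by positivity), mul_comm]; exact hk.2.1⟩
        refine (sum_le_card_nsmul _ _ _ h3).trans ?_
        rw [nsmul_eq_mul]
        gcongr
        calc (#(blockVerts n (2 ^ I) (2 ^ (I + 1))) : ℝ) ≤ (n / 2 ^ I : ℕ) := by exact_mod_cast h4
          _ ≤ n / 2 ^ I := by
            have := Nat.cast_div_le (α := ℝ) (m := n) (n := 2 ^ I)
            exact_mod_cast this
      rw [sum_far_eq]
      have e : (n : ℝ) / 2 ^ I * (5 * ((I : ℝ) + 1)) +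
          n * (10 * (((I + 1 : ℕ) : ℝ) + 2) / 2 ^ (I + 1)) = n * (10 * ((I : ℝ) + 2) / 2 ^ I) := by
        push_cast
        rw [pow_succ]
        field_simp
        ring
      linarith
  refine hind n I (lt_of_lt_of_le Nat.lt_two_pow_self ?_)
  exact Nat.pow_le_pow_right two_pos (Nat.le_add_left _ _)

theorem sum_far_nonneg (n I : ℕ) : 0 ≤ ∑ k ∈ Icc 1 n with 2 ^ I * k ≤ n, lcmIncr n k :=
  sum_nonneg fun _ hk => lcmIncr_nonneg (mem_Icc.1 (mem_filter.1 hk).1).2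

/-- The part of the error that is proportional to the number of vertices. -/
noncomputable def tailError (I S : ℕ) (q : ℕ → ℕ) (θ : ℕ → ℝ) : ℝ :=
  ∑ i ∈ range I, 5 * ((i : ℝ) + 1) * (1 / 2 ^ i * (((S : ℝ) + 1) ^ (-θ i) *
    Real.exp (4 * (q i : ℝ) ^ θ i * primeRecipSum (q i)))) + 10 * ((I : ℝ) + 2) / 2 ^ I

/-- The part of the error coming from the sieve. -/
noncomputable def sieveError (I S : ℕ) (q : ℕ → ℕ) (n : ℕ) : ℝ :=
  ∑ i ∈ range I, 5 * ((i : ℝ) + 1) *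
    ∑ s ∈ smoothUpTo (q i) S, ∑ t ∈ Ico (s * 2 ^ i) (s * 2 ^ (i + 1)),
      |(roughCount (q i) n t : ℝ) - n / (t * (t + 1)) * roughDensity (q i)|

noncomputable def totalCenter (I S : ℕ) (q : ℕ → ℕ) : ℝ :=
  ∑ i ∈ range I, blockCenter (2 ^ i) (2 ^ (i + 1)) (q i) S

theorem abs_log_ncard_sub_le {I S : ℕ} {q : ℕ → ℕ} {θ : ℕ → ℝ}
    (hq : ∀ i < I, 2 ^ (i + 1) ≤ q i) (hθ0 : ∀ i < I, 0 < θ i) (hθ1 : ∀ i < I, θ i ≤ 1 / 2)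
    (n : ℕ) :
    |Real.log (Slcm n).ncard - n * totalCenter I S q| ≤
      n * tailError I S q θ + sieveError I S q n := by
  rw [log_ncard_Slcm_eq_blocks n I, totalCenter, mul_sum, add_sub_right_comm, ← sum_sub_distrib]
  refine (abs_add_le _ _).trans ?_
  rw [abs_of_nonneg (sum_far_nonneg n I), tailError, sieveError, mul_add, mul_sum,
    add_right_comm, ← sum_add_distrib]
  refine add_le_add ?_ (sum_far_le n I)
  refine (abs_sum_le_sum_abs _ _).trans (sum_le_sum fun i hi => ?_)
  have hi := mem_range.1 hi
  refine (abs_block_sub_le Nat.one_le_two_pow Nat.one_le_two_pow (hq i hi) (hθ0 i hi)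
    (hθ1 i hi)).trans ?_
  refine (mul_le_mul_of_nonneg_right (log_two_add_le i) (by positivity)).trans (le_of_eq ?_)
  push_cast
  ring

/-- With the parameters fixed, the sieve level may exceed the number of primes. The tail over large
T is then empty and the error does not depend on n. -/
theorem sieveError_le_const (I S : ℕ) (q : ℕ → ℕ) : ∃ K : ℝ, ∀ n, sieveError I S q n ≤ K := by
  have hrough : ∀ i, ∃ K : ℝ, ∀ n t : ℕ, 0 < t →
      |(roughCount (q i) n t : ℝ) - n / (t * (t + 1)) * roughDensity (q i)| ≤ K := by
    intro i
    refine ⟨#{T ∈ (q i).primesBelow.powerset | #T ≤ #(q i).primesBelow + 1}, fun n t ht => ?_⟩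
    have h := brun_sieve (q i).primesBelow (fun p hp => Nat.prime_of_mem_primesBelow hp) n t
      (#(q i).primesBelow + 1) ht
    have h0 : {T ∈ (q i).primesBelow.powerset | #(q i).primesBelow + 1 ≤ #T} = ∅ := by
      refine filter_false_of_mem fun T hT => ?_
      have := card_le_card (mem_powerset.1 hT)
      omega
    rw [h0, sum_empty, mul_zero, add_zero] at h
    exact h
  choose K hK using hrough
  refine ⟨∑ i ∈ range I, 5 * ((i : ℝ) + 1) * ∑ s ∈ smoothUpTo (q i) S,
    ∑ _t ∈ Ico (s * 2 ^ i) (s * 2 ^ (i + 1)), K i, fun n => ?_⟩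
  refine sum_le_sum fun i _ => ?_
  gcongr with s hs t ht
  refine hK i n t ?_
  simp only [smoothUpTo, mem_filter, mem_Icc] at hs
  exact lt_of_lt_of_le (Nat.mul_pos hs.1.1 (by positivity)) (mem_Ico.1 ht).1

/-- The normalized logarithm of the number of permutations. -/
noncomputable def logRate (n : ℕ) : ℝ := Real.log (Slcm n).ncard / n

theorem abs_logRate_sub_le {I S : ℕ} {q : ℕ → ℕ} {θ : ℕ → ℝ}
    (hq : ∀ i < I, 2 ^ (i + 1) ≤ q i) (hθ0 : ∀ i < I, 0 < θ i) (hθ1 : ∀ i < I, θ i ≤ 1 / 2)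
    {n : ℕ} (hn : 0 < n) :
    |logRate n - totalCenter I S q| ≤ tailError I S q θ + sieveError I S q n / n := by
  have hnR : (0 : ℝ) < n := by exact_mod_cast hn
  have h := abs_log_ncard_sub_le (S := S) hq hθ0 hθ1 n
  have e : logRate n - totalCenter I S q =
      (Real.log (Slcm n).ncard - n * totalCenter I S q) / n := by
    rw [logRate]; field_simp
  rw [e, abs_div, abs_of_pos hnR, div_le_iff₀ hnR]
  refine h.trans (le_of_eq ?_)
  field_simp

theorem eventually_abs_logRate_sub_le {I S : ℕ} {q : ℕ → ℕ} {θ : ℕ → ℝ}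
    (hq : ∀ i < I, 2 ^ (i + 1) ≤ q i) (hθ0 : ∀ i < I, 0 < θ i) (hθ1 : ∀ i < I, θ i ≤ 1 / 2)
    {η : ℝ} (hη : 0 < η) :
    ∀ᶠ n : ℕ in Filter.atTop, |logRate n - totalCenter I S q| ≤ tailError I S q θ + η := by
  obtain ⟨K, hK⟩ := sieveError_le_const I S q
  have h1 : Filter.Tendsto (fun n : ℕ => K / (n : ℝ)) Filter.atTop (nhds 0) :=
    tendsto_const_div_atTop_nhds_zero_nat K
  filter_upwards [h1.eventually (gt_mem_nhds hη), Filter.eventually_gt_atTop 0] with n hn hn0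
  refine (abs_logRate_sub_le (S := S) hq hθ0 hθ1 hn0).trans ?_
  have : sieveError I S q n / n ≤ K / n := by gcongr; exact hK n
  linarith

/-- A sequence that is eventually close to a centre for each precision converges. -/
theorem exists_tendsto_of_centers {f e : ℕ → ℝ} (he : Filter.Tendsto e Filter.atTop (nhds 0))
    (h : ∀ᶠ n in Filter.atTop, ∃ C, |f n - C| ≤ e n ∧
      ∀ η > 0, ∀ᶠ m in Filter.atTop, |f m - C| ≤ e n + η) :
    ∃ L, Filter.Tendsto f Filter.atTop (nhds L) := by
  refine cauchySeq_tendsto_of_complete (Metric.cauchySeq_iff'.2 fun ε hε => ?_)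
  obtain ⟨n, ⟨C, -, hC⟩, hn⟩ := (h.and (he.eventually (gt_mem_nhds (show 0 < ε / 4 by
    linarith)))).exists
  obtain ⟨N, hN⟩ := Filter.eventually_atTop.1 (hC (ε / 8) (by linarith))
  refine ⟨N, fun m hm => ?_⟩
  have h1 := hN m hm
  have h2 := hN N le_rfl
  rw [Real.dist_eq]
  rw [abs_le] at h1 h2
  rw [abs_lt]
  constructor <;> linarith

/-- The limit inherits the distance e from C, so f n and L are both within e of C. The centre itself
may vary with n. -/
theorem abs_sub_lim_le_of_center {f : ℕ → ℝ} {L C e : ℝ} {n : ℕ}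
    (hL : Filter.Tendsto f Filter.atTop (nhds L)) (h1 : |f n - C| ≤ e)
    (h2 : ∀ η > 0, ∀ᶠ m in Filter.atTop, |f m - C| ≤ e + η) : |f n - L| ≤ 2 * e := by
  have h3 : |L - C| ≤ e := by
    refine le_of_forall_pos_le_add fun η hη => ?_
    exact le_of_tendsto ((hL.sub_const C).abs) (h2 η hη)
  have := abs_sub_le (f n) C L
  rw [abs_sub_comm C L] at this
  linarith

end Decomposition

/-! ### A Mertens-type bound from Chebyshev's estimate. -/

section Mertens

open Finset

/-- Each prime of the dyadic range contributes at least (j + 1) log 2 to `Chebyshev.theta`, which is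
at most log 4 times its argument. This bounds the number of primes there. -/
theorem sum_dyadic_primes_le (j : ℕ) :
    ∑ p ∈ Nat.primesBelow (2 ^ (j + 2)) with 2 ^ (j + 1) ≤ p, 1 / (p : ℝ) ≤ 4 * ((j : ℝ) + 1)⁻¹ := by
  set D := (Nat.primesBelow (2 ^ (j + 2))).filter fun p => 2 ^ (j + 1) ≤ p with hD
  have hDp : ∀ p ∈ D, p.Prime ∧ p < 2 ^ (j + 2) ∧ 2 ^ (j + 1) ≤ p := fun p hp => by
    obtain ⟨h1, h2⟩ := mem_filter.1 hp
    exact ⟨Nat.prime_of_mem_primesBelow h1, Nat.lt_of_mem_primesBelow h1, h2⟩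
  have h2 : (#D : ℝ) * (((j : ℝ) + 1) * Real.log 2) ≤ Real.log 4 * 2 ^ (j + 2) := by
    have h3 : (#D : ℝ) * (((j : ℝ) + 1) * Real.log 2) ≤ Chebyshev.theta (2 ^ (j + 2)) := by
      rw [Chebyshev.theta_eq_sum_Icc, ← nsmul_eq_mul]
      refine (card_nsmul_le_sum D (fun p => Real.log p) _ fun p hp => ?_).trans
        (sum_le_sum_of_subset_of_nonneg (fun p hp => ?_) fun p hp _ => ?_)
      · have h4 : (2 : ℝ) ^ (j + 1) ≤ p := by exact_mod_cast (hDp p hp).2.2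
        have h5 := Real.log_le_log (by positivity) h4
        rw [Real.log_pow] at h5
        exact_mod_cast h5
      · obtain ⟨h4, h5, h6⟩ := hDp p hp
        refine mem_filter.2 ⟨mem_Icc.2 ⟨Nat.zero_le _, Nat.le_floor ?_⟩, h4⟩
        exact_mod_cast h5.le
      · exact Real.log_natCast_nonneg p
    exact h3.trans (Chebyshev.theta_le_log4_mul_x (by positivity))
  have hl2 : 0 < Real.log 2 := Real.log_pos one_lt_two
  have hl4 : Real.log 4 = 2 * Real.log 2 := by
    rw [show (4 : ℝ) = 2 ^ 2 by norm_num, Real.log_pow]; norm_num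
  have h6 : (#D : ℝ) * ((j : ℝ) + 1) ≤ 4 * 2 ^ (j + 1) := by
    rw [hl4] at h2
    have : (#D : ℝ) * ((j : ℝ) + 1) * Real.log 2 ≤ 4 * 2 ^ (j + 1) * Real.log 2 := by
      rw [pow_succ (2 : ℝ) (j + 1)] at h2; linarith
    exact le_of_mul_le_mul_right this hl2
  calc ∑ p ∈ D, 1 / (p : ℝ) ≤ #D • (1 / 2 ^ (j + 1) : ℝ) := by
        refine sum_le_card_nsmul _ _ _ fun p hp => ?_
        have h4 : (2 : ℝ) ^ (j + 1) ≤ p := by exact_mod_cast (hDp p hp).2.2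
        gcongr
    _ ≤ 4 * ((j : ℝ) + 1)⁻¹ := by
        rw [nsmul_eq_mul, mul_one_div, ← div_eq_mul_inv, div_le_div_iff₀ (by positivity)
          (by positivity)]
        exact h6

theorem primeRecipSum_two_pow_le (J : ℕ) :
    primeRecipSum (2 ^ (J + 1)) ≤ 4 * (harmonic J : ℝ) := by
  induction J with
  | zero =>
    have : (2 ^ (0 + 1)).primesBelow = ∅ := by decide
    rw [primeRecipSum, this]; simp
  | succ J ih =>
    rw [primeRecipSum, ← sum_filter_add_sum_filter_not _ (fun p => 2 ^ (J + 1) ≤ p), add_comm,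
      harmonic_succ]
    push_cast
    rw [mul_add]
    refine add_le_add (le_trans (le_of_eq ?_) ih) (sum_dyadic_primes_le J)
    rw [primeRecipSum]
    refine sum_congr ?_ fun _ _ => rfl
    ext p
    simp only [mem_filter, Nat.mem_primesBelow, not_le]
    constructor
    · rintro ⟨⟨h1, h2⟩, h3⟩; exact ⟨h3, h2⟩
    · rintro ⟨h1, h2⟩
      exact ⟨⟨h1.trans (Nat.pow_lt_pow_right one_lt_two (by omega)), h2⟩, h1⟩

theorem primeRecipSum_mono {q q' : ℕ} (h : q ≤ q') : primeRecipSum q ≤ primeRecipSum q' :=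
  sum_le_sum_of_subset_of_nonneg (fun p hp => Nat.mem_primesBelow.2
    ⟨(Nat.lt_of_mem_primesBelow hp).trans_le h, Nat.prime_of_mem_primesBelow hp⟩)
    fun p _ _ => by positivity

theorem primeRecipSum_nonneg (q : ℕ) : 0 ≤ primeRecipSum q :=
  sum_nonneg fun p _ => by positivity

/-- An upper bound of Mertens type. -/
theorem primeRecipSum_le {q : ℕ} (hq : 2 ≤ q) :
    primeRecipSum q ≤ 8 + 4 * Real.log (Real.log q) := by
  have hJ : 1 ≤ Nat.log 2 q := Nat.log_pos one_lt_two hq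
  have h1 : q ≤ 2 ^ (Nat.log 2 q + 1) := (Nat.lt_pow_succ_log_self one_lt_two q).le
  have h2 : (2 : ℝ) ^ Nat.log 2 q ≤ q := by
    exact_mod_cast Nat.pow_log_le_self 2 (by omega)
  have h3 := Real.log_le_log (by positivity) h2
  rw [Real.log_pow] at h3
  have hJR : (1 : ℝ) ≤ Nat.log 2 q := by exact_mod_cast hJ
  have hl2 := Real.log_two_gt_d9
  have h4 : (Nat.log 2 q : ℝ) ≤ 2 * Real.log q := by nlinarith
  have h5 : Real.log (Nat.log 2 q) ≤ Real.log 2 + Real.log (Real.log q) := by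
    rw [← Real.log_mul two_ne_zero (by nlinarith)]
    exact Real.log_le_log (by linarith) h4
  have h6 := harmonic_le_one_add_log (Nat.log 2 q)
  have h7 := (primeRecipSum_mono h1).trans (primeRecipSum_two_pow_le _)
  linarith [Real.log_two_lt_d9]

end Mertens

/-! ### Quantitative sieve error. -/

section SieveEstimate

open Finset

/-- The sieve level B is the floor of (1 - ε) log Y / log q, so that q^B ≤ Y^(1 - ε). With Rankin
weight q^θ, the tail then saves Y^(-(1 - ε)θ) at the cost of one factor q^θ from the floor. -/
theorem abs_roughCount_sub_le {q n t x : ℕ} (hq : 2 ≤ q) (hx : 1 ≤ x) (hxt : x ≤ t)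
    {θ ε Y : ℝ} (hθ : 0 < θ) (hε : ε ≤ 1) (hY : Y = n / (x : ℝ) ^ 2) (hY1 : 1 ≤ Y) :
    |(roughCount q n t : ℝ) - n / (t * (t + 1)) * roughDensity q| ≤
      Y ^ (1 - ε) + 2 * Y * ((q : ℝ) ^ θ * Y ^ (-((1 - ε) * θ)) *
        Real.exp ((q : ℝ) ^ θ * primeRecipSum q)) := by
  have hq1 : (1 : ℝ) < q := by exact_mod_cast hq
  have hq0 : (0 : ℝ) < q := by linarith
  have hlq : 0 < Real.log q := Real.log_pos hq1
  have hz1 : 1 ≤ (q : ℝ) ^ θ := Real.one_le_rpow hq1.le hθ.le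
  have hz0 : 0 < (q : ℝ) ^ θ := by linarith
  have hlY : 0 ≤ Real.log Y := Real.log_nonneg hY1
  have hY0 : 0 < Y := by linarith
  set u : ℝ := (1 - ε) * Real.log Y / Real.log q with hu
  have hu0 : 0 ≤ u := div_nonneg (mul_nonneg (by linarith) hlY) hlq.le
  set B := ⌊u⌋₊ with hB
  have hP : ∀ p ∈ q.primesBelow, p.Prime := fun p hp => Nat.prime_of_mem_primesBelow hp
  have h := brun_sieve q.primesBelow hP n t B (by omega)
  have hc : (#{T ∈ q.primesBelow.powerset | #T ≤ B} : ℝ) ≤ Y ^ (1 - ε) := by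
    have h1 := card_powerset_card_le q.primesBelow hP (q := q) (by omega)
      (fun p hp => (Nat.lt_of_mem_primesBelow hp).le) B
    have h2 : (#{T ∈ q.primesBelow.powerset | #T ≤ B} : ℝ) ≤ (q : ℝ) ^ (B : ℝ) := by
      rw [Real.rpow_natCast]; exact_mod_cast h1
    refine h2.trans ((Real.rpow_le_rpow_of_exponent_le hq1.le (Nat.floor_le hu0)).trans
      (le_of_eq ?_))
    rw [Real.rpow_def_of_pos hq0, Real.rpow_def_of_pos hY0, hu]
    congr 1
    field_simp
  have hs := (sum_powerset_card_ge_le q.primesBelow hz1 B).trans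
    (mul_le_mul_of_nonneg_left (prod_one_add_div_le q hz0.le) (by positivity))
  have hzB : (((q : ℝ) ^ θ)⁻¹) ^ B ≤ (q : ℝ) ^ θ * Y ^ (-((1 - ε) * θ)) := by
    have h1 : Y ^ ((1 - ε) * θ) ≤ (q : ℝ) ^ θ * ((q : ℝ) ^ θ) ^ B := by
      rw [← pow_succ', ← Real.rpow_natCast, ← Real.rpow_mul hq0.le, Real.rpow_def_of_pos hY0,
        Real.rpow_def_of_pos hq0]
      apply Real.exp_le_exp.2
      have h2 : u < (B + 1 : ℕ) := by push_cast; exact Nat.lt_floor_add_one u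
      have h3 : Real.log Y * ((1 - ε) * θ) = Real.log q * (θ * u) := by
        rw [hu]; field_simp
      rw [h3]
      gcongr
    rw [inv_pow, Real.rpow_neg hY0.le, ← div_eq_mul_inv, le_div_iff₀ (by positivity),
      inv_mul_le_iff₀ (by positivity)]
    exact h1.trans (le_of_eq (mul_comm _ _))
  have hy : (n : ℝ) / (t * (t + 1)) ≤ Y := by
    rw [hY]
    have h1 : (1 : ℝ) ≤ x := by exact_mod_cast hx
    have h2 : (x : ℝ) ≤ t := by exact_mod_cast hxt
    apply div_le_div_of_nonneg_left (Nat.cast_nonneg n) (by positivity)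
    nlinarith
  refine h.trans (add_le_add hc ?_)
  have h3 : ∑ T ∈ q.primesBelow.powerset with B ≤ #T, ∏ p ∈ T, 1 / (p : ℝ) ≤
      (q : ℝ) ^ θ * Y ^ (-((1 - ε) * θ)) * Real.exp ((q : ℝ) ^ θ * primeRecipSum q) :=
    hs.trans (mul_le_mul_of_nonneg_right hzB (Real.exp_nonneg _))
  have h4 : 0 ≤ ∑ T ∈ q.primesBelow.powerset with B ≤ #T, ∏ p ∈ T, 1 / (p : ℝ) :=
    sum_nonneg fun T _ => prod_nonneg fun p _ => by positivity
  have h5 : 2 * ((n : ℝ) / (t * (t + 1))) ≤ 2 * Y := by linarith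
  exact mul_le_mul h5 h3 h4 (by linarith)

/-- For each s there are s a values of t, which turns Y into n/(s a). Bounding each inner sum by a
multiple of s^(θ - 1) lets Rankin's bound handle the sum over s. -/
theorem sum_abs_roughCount_sub_le {q n a S : ℕ} (hn : 1 ≤ n) (ha : 1 ≤ a) (haq : 2 * a ≤ q)
    {θ ε : ℝ} (hθ0 : 0 < θ) (hθ1 : θ ≤ 1 / 2) (hε0 : 0 < ε) (hε1 : ε ≤ 1)
    (hS : (S : ℝ) ≤ (n : ℝ) ^ (1 / 2 - ε)) (han : (a : ℝ) ^ 2 ≤ (n : ℝ) ^ ε) :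
    ∑ s ∈ smoothUpTo q S, ∑ t ∈ Ico (s * a) (s * (2 * a)),
      |(roughCount q n t : ℝ) - n / (t * (t + 1)) * roughDensity q| ≤
      n * (Real.exp (5 * (q : ℝ) ^ θ * primeRecipSum q) *
        ((n : ℝ) ^ (-ε ^ 2) + 2 * ((q : ℝ) ^ θ) ^ 3 * (1 / a * (n : ℝ) ^ (-((1 / 2 - ε) * θ))))) := by
  have hnR : (1 : ℝ) ≤ n := by exact_mod_cast hn
  have hn0 : (0 : ℝ) < n := by linarith
  have haR : (1 : ℝ) ≤ a := by exact_mod_cast ha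
  have hqa : (a : ℝ) ≤ q := by exact_mod_cast (by omega : a ≤ q)
  set z : ℝ := (q : ℝ) ^ θ with hz
  have hz1 : 1 ≤ z := Real.one_le_rpow (by linarith) hθ0.le
  have hz0 : 0 < z := by linarith
  set G : ℝ := Real.exp (z * primeRecipSum q) with hG
  set F : ℝ := (n : ℝ) ^ (-ε ^ 2) +
    2 * z ^ 3 * (1 / a * (n : ℝ) ^ (-((1 / 2 - ε) * θ))) with hF
  have hG1 : 1 ≤ G := Real.one_le_exp (mul_nonneg hz0.le (primeRecipSum_nonneg q))
  have key : ∀ s ∈ smoothUpTo q S, ∑ t ∈ Ico (s * a) (s * (2 * a)),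
      |(roughCount q n t : ℝ) - n / (t * (t + 1)) * roughDensity q| ≤
        n * G * F * (s : ℝ) ^ (θ - 1) := by
    intro s hs
    simp only [smoothUpTo, mem_filter, mem_Icc] at hs
    obtain ⟨⟨hs1, hsS⟩, -⟩ := hs
    have hs1R : (1 : ℝ) ≤ s := by exact_mod_cast hs1
    have hs0 : (0 : ℝ) < s := by linarith
    have hsSR : (s : ℝ) ≤ (n : ℝ) ^ (1 / 2 - ε) :=
      le_trans (by exact_mod_cast hsS) hS
    have hx1 : 1 ≤ s * a := Nat.mul_pos hs1 ha
    have hxR : (1 : ℝ) ≤ s * a := by exact_mod_cast hx1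
    set Y : ℝ := n / ((s * a : ℕ) : ℝ) ^ 2 with hY
    have hYn : (n : ℝ) ^ ε ≤ Y := by
      rw [hY, le_div_iff₀ (by positivity)]
      push_cast
      calc (n : ℝ) ^ ε * (s * a) ^ 2 = (n : ℝ) ^ ε * ((s : ℝ) ^ 2 * (a : ℝ) ^ 2) := by ring
        _ ≤ (n : ℝ) ^ ε * (((n : ℝ) ^ (1 / 2 - ε)) ^ 2 * (n : ℝ) ^ ε) := by gcongr
        _ = n := by
          rw [← Real.rpow_natCast ((n : ℝ) ^ (1 / 2 - ε)), ← Real.rpow_mul hn0.le,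
            ← Real.rpow_add hn0, ← Real.rpow_add hn0]
          conv_rhs => rw [← Real.rpow_one (n : ℝ)]
          congr 1
          push_cast
          ring
    have hY1 : 1 ≤ Y := (Real.one_le_rpow hnR hε0.le).trans hYn
    have hY0 : 0 < Y := by linarith
    have h1 : ∑ t ∈ Ico (s * a) (s * (2 * a)),
        |(roughCount q n t : ℝ) - n / (t * (t + 1)) * roughDensity q| ≤
        (s * a : ℝ) * (Y ^ (1 - ε) + 2 * Y * (z * Y ^ (-((1 - ε) * θ)) * G)) := by
      refine (sum_le_card_nsmul _ _ _ fun t ht => abs_roughCount_sub_le (by omega) hx1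
        (mem_Ico.1 ht).1 hθ0 hε1 hY hY1).trans (le_of_eq ?_)
      rw [Nat.card_Ico, nsmul_eq_mul, show s * (2 * a) - s * a = s * a by
        rw [mul_left_comm, two_mul]; omega]
      push_cast
      rfl
    have hsaY : (s * a : ℝ) * Y = n / (s * a) := by
      rw [hY]; push_cast; field_simp
    have h2 : Y ^ (1 - ε) ≤ Y * (n : ℝ) ^ (-ε ^ 2) := by
      rw [sub_eq_add_neg, Real.rpow_add hY0, Real.rpow_one]
      gcongr
      calc Y ^ (-ε) ≤ ((n : ℝ) ^ ε) ^ (-ε) :=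
            Real.rpow_le_rpow_of_nonpos (by positivity) hYn (by linarith)
        _ = (n : ℝ) ^ (-ε ^ 2) := by rw [← Real.rpow_mul hn0.le]; congr 1; ring
    -- Of the factor (s a)^(2θ), one s^θ is absorbed by the power of n, the other is kept for the
    -- sum over s, and a^(2θ) ≤ z².
    have h3 : Y ^ (-((1 - ε) * θ)) ≤ (n : ℝ) ^ (-((1 / 2 - ε) * θ)) * z ^ 2 * (s : ℝ) ^ θ := by
      have e1 : Y ^ (-((1 - ε) * θ)) =
          (n : ℝ) ^ (-((1 - ε) * θ)) * (s * a : ℝ) ^ (2 * ((1 - ε) * θ)) := by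
        rw [hY, Real.div_rpow hn0.le (by positivity), Real.rpow_neg (x := ((s * a : ℕ) : ℝ) ^ 2)
          (by positivity), div_inv_eq_mul, ← Real.rpow_natCast, ← Real.rpow_mul (by positivity)]
        push_cast
        rfl
      have e2 : (s * a : ℝ) ^ (2 * ((1 - ε) * θ)) ≤ (s * a : ℝ) ^ (2 * θ) :=
        Real.rpow_le_rpow_of_exponent_le hxR (by nlinarith)
      have e3 : (s * a : ℝ) ^ (2 * θ) = (s : ℝ) ^ θ * (s : ℝ) ^ θ * ((a : ℝ) ^ θ) ^ 2 := by
        rw [Real.mul_rpow hs0.le (by linarith), two_mul, Real.rpow_add hs0,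
          Real.rpow_add (by linarith : (0 : ℝ) < a), pow_two]
      have e4 : (a : ℝ) ^ θ ≤ z := Real.rpow_le_rpow (by linarith) hqa hθ0.le
      have e5 : (s : ℝ) ^ θ ≤ (n : ℝ) ^ ((1 / 2 - ε) * θ) := by
        rw [Real.rpow_mul hn0.le]
        exact Real.rpow_le_rpow hs0.le hsSR hθ0.le
      have e6 : (n : ℝ) ^ (-((1 - ε) * θ)) * (n : ℝ) ^ ((1 / 2 - ε) * θ) ≤
          (n : ℝ) ^ (-((1 / 2 - ε) * θ)) := by
        rw [← Real.rpow_add hn0]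
        exact Real.rpow_le_rpow_of_exponent_le hnR (by nlinarith)
      calc Y ^ (-((1 - ε) * θ)) ≤ (n : ℝ) ^ (-((1 - ε) * θ)) *
            ((s : ℝ) ^ θ * (s : ℝ) ^ θ * ((a : ℝ) ^ θ) ^ 2) := by
            rw [e1, ← e3]; gcongr
        _ ≤ (n : ℝ) ^ (-((1 - ε) * θ)) * ((n : ℝ) ^ ((1 / 2 - ε) * θ) * (s : ℝ) ^ θ * z ^ 2) := by
            gcongr
        _ = ((n : ℝ) ^ (-((1 - ε) * θ)) * (n : ℝ) ^ ((1 / 2 - ε) * θ)) * z ^ 2 * (s : ℝ) ^ θ := by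
            ring
        _ ≤ _ := by gcongr
    have h4 : 1 ≤ (s : ℝ) ^ θ := Real.one_le_rpow hs1R hθ0.le
    have h5 : (s : ℝ) ^ (θ - 1) = (s : ℝ) ^ θ / s := by
      rw [Real.rpow_sub hs0, Real.rpow_one]
    have hN0 : 0 < (n : ℝ) ^ (-ε ^ 2) := by positivity
    have hM0 : 0 < (n : ℝ) ^ (-((1 / 2 - ε) * θ)) := by positivity
    calc _ ≤ (s * a : ℝ) * (Y ^ (1 - ε) + 2 * Y * (z * Y ^ (-((1 - ε) * θ)) * G)) := h1
      _ ≤ (s * a : ℝ) * (Y * (n : ℝ) ^ (-ε ^ 2) + 2 * Y *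
          (z * ((n : ℝ) ^ (-((1 / 2 - ε) * θ)) * z ^ 2 * (s : ℝ) ^ θ) * G)) := by
          gcongr
      _ = ((s * a : ℝ) * Y) * ((n : ℝ) ^ (-ε ^ 2) +
          2 * z ^ 3 * (n : ℝ) ^ (-((1 / 2 - ε) * θ)) * (s : ℝ) ^ θ * G) := by ring
      _ = n / s * (1 / a * (n : ℝ) ^ (-ε ^ 2) +
          2 * z ^ 3 * (1 / a * (n : ℝ) ^ (-((1 / 2 - ε) * θ))) * (s : ℝ) ^ θ * G) := by
          rw [hsaY]; field_simp
      _ ≤ n / s * (1 * (n : ℝ) ^ (-ε ^ 2) * (s : ℝ) ^ θ * G +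
          2 * z ^ 3 * (1 / a * (n : ℝ) ^ (-((1 / 2 - ε) * θ))) * (s : ℝ) ^ θ * G) := by
          have h6 : 1 / (a : ℝ) ≤ 1 := by rw [div_le_one (by linarith)]; exact haR
          have h7 : 1 ≤ (s : ℝ) ^ θ * G := one_le_mul_of_one_le_of_one_le h4 hG1
          refine mul_le_mul_of_nonneg_left (add_le_add ?_ le_rfl) (by positivity)
          calc 1 / (a : ℝ) * (n : ℝ) ^ (-ε ^ 2) ≤ 1 * (n : ℝ) ^ (-ε ^ 2) := by gcongr
            _ ≤ 1 * (n : ℝ) ^ (-ε ^ 2) * ((s : ℝ) ^ θ * G) :=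
              le_mul_of_one_le_right (by positivity) h7
            _ = 1 * (n : ℝ) ^ (-ε ^ 2) * (s : ℝ) ^ θ * G := by ring
      _ = n * G * F * (s : ℝ) ^ (θ - 1) := by rw [hF, h5]; ring
  refine (sum_le_sum key).trans ?_
  rw [← mul_sum]
  have hR := sum_smooth_rpow_le q hθ0 hθ1 (smoothUpTo q S) fun s hs => by
    simp only [smoothUpTo, mem_filter] at hs; exact hs.2
  have hF0 : 0 ≤ F := by positivity
  calc n * G * F * ∑ s ∈ smoothUpTo q S, (s : ℝ) ^ (θ - 1)
      ≤ n * G * F * Real.exp (4 * z * primeRecipSum q) := by gcongr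
    _ = n * (Real.exp (5 * z * primeRecipSum q) * F) := by
        have : Real.exp (5 * z * primeRecipSum q) = G * Real.exp (4 * z * primeRecipSum q) := by
          rw [hG, ← Real.exp_add]; congr 1; ring
        rw [this]; ring

end SieveEstimate

/-! ### Choice of parameters. -/

section Asymptotics

open Finset

theorem sieveError_nonneg (I S : ℕ) (q : ℕ → ℕ) (n : ℕ) : 0 ≤ sieveError I S q n := by
  unfold sieveError; positivity

theorem sum_range_five_mul_le {I : ℕ} {x : ℝ} (h : (I : ℝ) ≤ x) :
    ∑ i ∈ range I, 5 * ((i : ℝ) + 1) ≤ 5 * x ^ 2 := by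
  have h0 : (0 : ℝ) ≤ I := Nat.cast_nonneg I
  calc ∑ i ∈ range I, 5 * ((i : ℝ) + 1) ≤ #(range I) • (5 * (I : ℝ)) := by
        refine sum_le_card_nsmul _ _ _ fun i hi => ?_
        have : (i : ℝ) + 1 ≤ I := by exact_mod_cast mem_range.1 hi
        linarith
    _ = 5 * (I : ℝ) ^ 2 := by rw [card_range, nsmul_eq_mul]; ring
    _ ≤ 5 * x ^ 2 := by gcongr

/-- The trade-off between the size of a block and the saving from smoothness. -/
theorem inv_mul_rpow_le {n q a : ℝ} {ε x Λ θ : ℝ} (hn : 0 < n) (hx : x = Real.log n)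
    (hx0 : 0 < x) (hΛ2 : Λ ^ 2 = x * Real.log x) (hq : 1 < q) (ha : 0 < a) (hqa : q ≤ 4 * x * a)
    (hθ : θ = (1 / 2 - ε) * Real.log x / Real.log q) :
    1 / a * n ^ (-((1 / 2 - ε) * θ)) ≤ 4 * x * Real.exp (-(1 - 2 * ε) * Λ) := by
  have hlq0 : 0 < Real.log q := Real.log_pos hq
  have hq0 : (0 : ℝ) < q := by linarith
  have h5 : 1 / a ≤ 4 * x * Real.exp (-Real.log q) := by
    rw [Real.exp_neg, Real.exp_log hq0, ← div_eq_mul_inv, div_le_div_iff₀ ha hq0]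
    linarith
  have h6 : n ^ (-((1 / 2 - ε) * θ)) =
      Real.exp (-((1 / 2 - ε) ^ 2 * Λ ^ 2 / Real.log q)) := by
    rw [Real.rpow_def_of_pos hn, ← hx, hΛ2, hθ]
    congr 1
    ring
  rw [h6]
  calc _ ≤ 4 * x * Real.exp (-Real.log q) *
        Real.exp (-((1 / 2 - ε) ^ 2 * Λ ^ 2 / Real.log q)) := by gcongr
    _ = 4 * x * Real.exp (-Real.log q + -((1 / 2 - ε) ^ 2 * Λ ^ 2 / Real.log q)) := by
        rw [mul_assoc, ← Real.exp_add]
    _ ≤ _ := by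
        -- Arithmetic-geometric mean inequality: block size saves log q, smoothness saves (1/2 -
        -- ε)²Λ²/log q. The worst balance gives (1 - 2ε)Λ, the source of the exponent √(log n log
        -- log n) with constant 1.
        have h7 : 2 * ((1 / 2 - ε) * Λ) ≤ Real.log q + (1 / 2 - ε) ^ 2 * Λ ^ 2 / Real.log q := by
          rw [← sub_nonneg]
          have e : Real.log q + (1 / 2 - ε) ^ 2 * Λ ^ 2 / Real.log q - 2 * ((1 / 2 - ε) * Λ) =
              (Real.log q - (1 / 2 - ε) * Λ) ^ 2 / Real.log q := by
            field_simp; ring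
          rw [e]; positivity
        refine mul_le_mul_of_nonneg_left (Real.exp_le_exp.2 ?_) (by positivity)
        linarith

/-- The choice of θ makes q^θ = z = x^(1/2 - ε) in every block. So all the exponential factors are
bounded by one G, which is negligible against exp(εΛ), and T is the saving from `inv_mul_rpow_le`.
-/
theorem block_bounds {n q i S : ℕ} {ε x Λ z G T θ : ℝ} (hn : 1 ≤ n) (hx : x = Real.log n)
    (hε0 : 0 < ε) (hε1 : ε < 1 / 4) (hx3 : 3 ≤ x) (hL : 1 ≤ Real.log x)
    (hΛ0 : 0 ≤ Λ) (hΛ2 : Λ ^ 2 = x * Real.log x) (h2 : 2 * Λ ≤ ε * x) (h3 : Λ ≤ ε ^ 2 * x)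
    (hz : z = x ^ (1 / 2 - ε)) (hG : G = Real.exp (5 * z * (8 + 4 * Real.log x)))
    (hT : T = Real.exp (-(1 - 2 * ε) * Λ)) (hS : S = ⌊(n : ℝ) ^ (1 / 2 - ε)⌋₊)
    (hθ : θ = Real.log z / Real.log q) (hqx : x ≤ q) (hqa : (q : ℝ) ≤ 4 * x * 2 ^ i)
    (hqn : (q : ℝ) ≤ n) (hq2 : 2 ^ (i + 1) ≤ q) (hi : (2 : ℝ) ^ i ≤ Real.exp Λ) :
    0 < θ ∧ θ ≤ 1 / 2 ∧
      1 / 2 ^ i * (((S : ℝ) + 1) ^ (-θ) *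
        Real.exp (4 * (q : ℝ) ^ θ * primeRecipSum q)) ≤ 4 * x * T * G ∧
      ∑ s ∈ smoothUpTo q S, ∑ t ∈ Ico (s * 2 ^ i) (s * 2 ^ (i + 1)),
        |(roughCount q n t : ℝ) - n / (t * (t + 1)) * roughDensity q| ≤
          n * (G * (9 * x ^ 3 * T)) := by
  have hnR : (1 : ℝ) ≤ n := by exact_mod_cast hn
  have hn0 : (0 : ℝ) < n := by linarith
  have hx0 : 0 < x := by linarith
  have hz1 : 1 ≤ z := hz ▸ Real.one_le_rpow (by linarith) (by linarith)
  have hz0 : 0 < z := by linarith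
  have hlz : Real.log z = (1 / 2 - ε) * Real.log x := hz ▸ Real.log_rpow hx0 _
  have hlz0 : 0 < Real.log z := by rw [hlz]; exact mul_pos (by linarith) (by linarith)
  have hz2 : z ^ 2 ≤ x := by
    rw [hz, ← Real.rpow_natCast, ← Real.rpow_mul hx0.le]
    calc _ ≤ x ^ (1 : ℝ) := Real.rpow_le_rpow_of_exponent_le (by linarith) (by push_cast; linarith)
      _ = x := Real.rpow_one x
  have hq1 : (1 : ℝ) < q := by linarith
  have hlq : Real.log x ≤ Real.log q := Real.log_le_log hx0 hqx
  have hlq0 : 0 < Real.log q := by linarith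
  have hθ0 : 0 < θ := hθ ▸ div_pos hlz0 hlq0
  have hθ1 : θ ≤ 1 / 2 := by
    rw [hθ, div_le_iff₀ hlq0, hlz]
    nlinarith
  have hqθ : (q : ℝ) ^ θ = z := by
    rw [Real.rpow_def_of_pos (by linarith), hθ, mul_div_cancel₀ _ hlq0.ne', Real.exp_log hz0]
  have hM : primeRecipSum q ≤ 8 + 4 * Real.log x := by
    refine (primeRecipSum_le (by exact_mod_cast (by linarith : (2 : ℝ) ≤ q))).trans ?_
    have : Real.log (Real.log q) ≤ Real.log x := by
      apply Real.log_le_log hlq0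
      rw [hx]
      exact Real.log_le_log (by linarith) hqn
    linarith
  have hG5 : Real.exp (5 * z * primeRecipSum q) ≤ G :=
    hG ▸ Real.exp_le_exp.2 (mul_le_mul_of_nonneg_left hM (by linarith))
  have hG4 : Real.exp (4 * z * primeRecipSum q) ≤ G :=
    (Real.exp_le_exp.2 (mul_le_mul_of_nonneg_right (by linarith)
      (primeRecipSum_nonneg _))).trans hG5
  have hT0 : 0 < T := hT ▸ Real.exp_pos _
  have hG0 : 0 < G := hG ▸ Real.exp_pos _
  have hkey : 1 / (2 : ℝ) ^ i * (n : ℝ) ^ (-((1 / 2 - ε) * θ)) ≤ 4 * x * T := by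
    rw [hT]
    exact inv_mul_rpow_le hn0 hx hx0 hΛ2 hq1 (by positivity) hqa (by rw [hθ, hlz])
  refine ⟨hθ0, hθ1, ?_, ?_⟩
  · have hSlt : (n : ℝ) ^ (1 / 2 - ε) ≤ (S : ℝ) + 1 := hS ▸ (Nat.lt_floor_add_one _).le
    have h6 : ((S : ℝ) + 1) ^ (-θ) ≤ (n : ℝ) ^ (-((1 / 2 - ε) * θ)) := by
      rw [← mul_neg, Real.rpow_mul hn0.le]
      exact Real.rpow_le_rpow_of_nonpos (by positivity) hSlt (by linarith)
    rw [hqθ, ← mul_assoc]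
    have h7 : 1 / (2 : ℝ) ^ i * ((S : ℝ) + 1) ^ (-θ) ≤ 4 * x * T :=
      (mul_le_mul_of_nonneg_left h6 (by positivity)).trans hkey
    exact mul_le_mul h7 hG4 (Real.exp_nonneg _) (by positivity)
  · have h6 : ((2 ^ i : ℕ) : ℝ) ^ 2 ≤ (n : ℝ) ^ ε := by
      push_cast
      calc ((2 : ℝ) ^ i) ^ 2 ≤ Real.exp Λ ^ 2 := by gcongr
        _ = Real.exp (2 * Λ) := by rw [← Real.exp_nat_mul]; norm_num
        _ ≤ (n : ℝ) ^ ε := by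
          rw [Real.rpow_def_of_pos hn0, ← hx]
          exact Real.exp_le_exp.2 (by linarith)
    have e2 : 2 ^ (i + 1) = 2 * 2 ^ i := by rw [pow_succ, mul_comm]
    have h7 := sum_abs_roughCount_sub_le (q := q) (n := n) (a := 2 ^ i) (S := S) hn
      Nat.one_le_two_pow (e2 ▸ hq2) hθ0 hθ1 hε0
      (by linarith) (hS ▸ Nat.floor_le (by positivity)) h6
    rw [hqθ] at h7
    rw [e2]
    refine h7.trans ?_
    have h8 : (n : ℝ) ^ (-ε ^ 2) ≤ T := by
      rw [Real.rpow_def_of_pos hn0, ← hx, hT]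
      refine Real.exp_le_exp.2 ?_
      have : 0 ≤ ε * Λ := by positivity
      linarith
    have h9 : (n : ℝ) ^ (-ε ^ 2) +
        2 * z ^ 3 * (1 / ((2 ^ i : ℕ) : ℝ) * (n : ℝ) ^ (-((1 / 2 - ε) * θ))) ≤ 9 * x ^ 3 * T := by
      push_cast
      have h10 : 2 * z ^ 3 * (1 / (2 : ℝ) ^ i * (n : ℝ) ^ (-((1 / 2 - ε) * θ))) ≤
          2 * z ^ 3 * (4 * x * T) := mul_le_mul_of_nonneg_left hkey (by positivity)
      have hzx : z ≤ x := by nlinarith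
      have h11 : z ^ 3 ≤ x ^ 2 := by
        calc z ^ 3 = z ^ 2 * z := by ring
          _ ≤ x * x := by gcongr
          _ = x ^ 2 := by ring
      have h12 : z ^ 3 * (x * T) ≤ x ^ 2 * (x * T) :=
        mul_le_mul_of_nonneg_right h11 (by positivity)
      have h13 : 1 * T ≤ x ^ 3 * T :=
        mul_le_mul_of_nonneg_right (one_le_pow₀ (by linarith)) hT0.le
      linarith
    have h14 := mul_le_mul hG5 h9 (by positivity) hG0.le
    exact mul_le_mul_of_nonneg_left h14 hn0.le

/-- The choice of parameters, for `x = log n` and `Λ = √(x log x)`. -/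
theorem exists_params {n : ℕ} {ε x Λ : ℝ} (hn : 1 ≤ n) (hx : x = Real.log n)
    (hΛ : Λ = √(x * Real.log x)) (hε0 : 0 < ε) (hε1 : ε < 1 / 4) (hx3 : 3 ≤ x)
    (hL : 1 ≤ Real.log x) (h1 : 2 * Λ + 1 ≤ x) (h2 : 2 * Λ ≤ ε * x) (h3 : Λ ≤ ε ^ 2 * x)
    (h4 : Real.log 100 + 5 * Real.log x + 5 * x ^ (1 / 2 - ε) * (8 + 4 * Real.log x) ≤ ε * Λ) :
    ∃ (I S : ℕ) (q : ℕ → ℕ) (θ : ℕ → ℝ), (∀ i < I, 2 ^ (i + 1) ≤ q i) ∧ (∀ i < I, 0 < θ i) ∧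
      (∀ i < I, θ i ≤ 1 / 2) ∧
      tailError I S q θ + sieveError I S q n / n ≤ Real.exp (-(1 - 3 * ε) * Λ) := by
  have hnR : (1 : ℝ) ≤ n := by exact_mod_cast hn
  have hn0 : (0 : ℝ) < n := by linarith
  have hnx : (n : ℝ) = Real.exp x := by rw [hx, Real.exp_log hn0]
  have hx0 : 0 < x := by linarith
  have hΛ0 : 0 ≤ Λ := hΛ ▸ Real.sqrt_nonneg _
  have hΛ2 : Λ ^ 2 = x * Real.log x := by rw [hΛ, Real.sq_sqrt (by positivity)]
  have hl2 := Real.log_two_gt_d9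
  set z : ℝ := x ^ (1 / 2 - ε) with hz
  have hz1 : 1 ≤ z := Real.one_le_rpow (by linarith) (by linarith)
  -- Blocks are used until n/k is about e^Λ; beyond that the trivial bound is already of size e^(-Λ)
  -- up to powers of x.
  set I : ℕ := ⌈Λ / Real.log 2⌉₊ with hI
  have hI1 : Real.exp Λ ≤ 2 ^ I := by
    rw [← Real.rpow_natCast, Real.rpow_def_of_pos two_pos]
    apply Real.exp_le_exp.2
    have := Nat.le_ceil (Λ / Real.log 2)
    rwa [div_le_iff₀ (by linarith), mul_comm] at this
  have hIx : (I : ℝ) ≤ x := by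
    have := Nat.ceil_lt_add_one (show 0 ≤ Λ / Real.log 2 by positivity)
    have h5 : Λ / Real.log 2 ≤ 2 * Λ := by
      rw [div_le_iff₀ (by linarith)]; nlinarith
    linarith
  have hi2 : ∀ i < I, (2 : ℝ) ^ i ≤ Real.exp Λ := by
    intro i hi
    have := Nat.lt_ceil.1 hi
    rw [lt_div_iff₀ (by linarith)] at this
    rw [← Real.rpow_natCast, Real.rpow_def_of_pos two_pos]
    apply Real.exp_le_exp.2
    linarith
  have hceil := (Nat.ceil_lt_add_one hx0.le).le
  set G : ℝ := Real.exp (5 * z * (8 + 4 * Real.log x)) with hG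
  have hG1 : 1 ≤ G := Real.one_le_exp (by positivity)
  set T : ℝ := Real.exp (-(1 - 2 * ε) * Λ) with hT
  have hT0 : 0 < T := Real.exp_pos _
  -- In the maximum defining q, 2^(i+1) gives the locality condition and ⌈x⌉ gives θ ≤ 1/2. Still q
  -- ≤ 4x·2^i, as the trade-off between block size and smoothness requires.
  have hblock : ∀ i, i < I → _ := fun i hi =>
    block_bounds (n := n) (q := max (2 ^ (i + 1)) ⌈x⌉₊) (i := i)
      (S := ⌊(n : ℝ) ^ (1 / 2 - ε)⌋₊) hn hx hε0 hε1 hx3 hL hΛ0 hΛ2 h2 h3 hz hG hT rfl rfl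
      ((Nat.le_ceil x).trans (by exact_mod_cast le_max_right _ _))
      (by
        have h6 : (1 : ℝ) ≤ 2 ^ i := one_le_pow₀ (by norm_num)
        rw [Nat.cast_max]
        apply max_le
        · push_cast; rw [pow_succ]; nlinarith
        · nlinarith)
      (by
        rw [Nat.cast_max]
        apply max_le
        · push_cast
          have h6 := hi2 i hi
          have h7 : Real.exp Λ * Real.exp 1 ≤ n := by
            rw [hnx, ← Real.exp_add]; exact Real.exp_le_exp.2 (by linarith)
          have h8 := Real.exp_one_gt_d9
          rw [pow_succ]
          nlinarith [Real.exp_pos Λ]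
        · rw [hnx]; linarith [Real.add_one_le_exp x])
      (le_max_left _ _) (hi2 i hi)
  refine ⟨I, ⌊(n : ℝ) ^ (1 / 2 - ε)⌋₊, fun i => max (2 ^ (i + 1)) ⌈x⌉₊,
    fun i => Real.log z / Real.log (max (2 ^ (i + 1)) ⌈x⌉₊ : ℕ), fun i _ => le_max_left _ _,
    fun i hi => (hblock i hi).1, fun i hi => (hblock i hi).2.1, ?_⟩
  have htail : tailError I ⌊(n : ℝ) ^ (1 / 2 - ε)⌋₊ (fun i => max (2 ^ (i + 1)) ⌈x⌉₊)
      (fun i => Real.log z / Real.log (max (2 ^ (i + 1)) ⌈x⌉₊ : ℕ)) ≤ 50 * x ^ 3 * G * T := by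
    rw [tailError]
    have h6 := sum_le_sum fun i (hi : i ∈ range I) => mul_le_mul_of_nonneg_left
      (hblock i (mem_range.1 hi)).2.2.1 (show 0 ≤ 5 * ((i : ℝ) + 1) by positivity)
    rw [← sum_mul] at h6
    have h6' := h6.trans (mul_le_mul_of_nonneg_right (sum_range_five_mul_le hIx)
      (by positivity))
    have h7 : 10 * ((I : ℝ) + 2) / 2 ^ I ≤ 30 * x ^ 3 * G * T := by
      have h8 : Real.exp (-Λ) ≤ T := Real.exp_le_exp.2 (by nlinarith)
      have h9 : 10 * ((I : ℝ) + 2) / 2 ^ I ≤ 10 * ((I : ℝ) + 2) * Real.exp (-Λ) := by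
        rw [Real.exp_neg, div_eq_mul_inv]
        gcongr
      have h10 : 10 * ((I : ℝ) + 2) ≤ 30 * x ^ 3 := by
        have : x ≤ x ^ 3 := le_self_pow₀ (by linarith) (by norm_num)
        linarith
      calc _ ≤ 10 * ((I : ℝ) + 2) * Real.exp (-Λ) := h9
        _ ≤ 30 * x ^ 3 * T := by gcongr
        _ ≤ 30 * x ^ 3 * G * T := by
          have h11 := mul_le_mul_of_nonneg_left hG1 (show 0 ≤ 30 * x ^ 3 * T by positivity)
          linarith
    linarith
  have hsieve : sieveError I ⌊(n : ℝ) ^ (1 / 2 - ε)⌋₊ (fun i => max (2 ^ (i + 1)) ⌈x⌉₊) n / n ≤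
      50 * x ^ 5 * G * T := by
    rw [div_le_iff₀ hn0, sieveError]
    have h6 := sum_le_sum fun i (hi : i ∈ range I) => mul_le_mul_of_nonneg_left
      (hblock i (mem_range.1 hi)).2.2.2 (show 0 ≤ 5 * ((i : ℝ) + 1) by positivity)
    rw [← sum_mul] at h6
    refine (h6.trans (mul_le_mul_of_nonneg_right (sum_range_five_mul_le hIx)
      (by positivity))).trans ?_
    linarith [show 0 ≤ x ^ 5 * G * T * n by positivity]
  calc _ ≤ 50 * x ^ 3 * G * T + 50 * x ^ 5 * G * T := add_le_add htail hsieve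
    _ ≤ 100 * x ^ 5 * G * T := by
      have h5 : x ^ 3 * (G * T) ≤ x ^ 5 * (G * T) :=
        mul_le_mul_of_nonneg_right (pow_le_pow_right₀ (by linarith) (by norm_num)) (by positivity)
      linarith
    _ = Real.exp (Real.log 100 + 5 * Real.log x + 5 * z * (8 + 4 * Real.log x) +
          -(1 - 2 * ε) * Λ) := by
      rw [Real.exp_add, Real.exp_add, Real.exp_add, Real.exp_log (by norm_num),
        show (5 : ℝ) * Real.log x = (5 : ℕ) * Real.log x by norm_num, Real.exp_nat_mul,
        Real.exp_log hx0]
    _ ≤ Real.exp (-(1 - 3 * ε) * Λ) := Real.exp_le_exp.2 (by linarith)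

end Asymptotics

/-! ### The limit, its rate and its positivity. -/

section Limit

open Filter

/-- The exponent `√(log n · log log n)` of the rate of convergence. -/
noncomputable def rateExponent (n : ℕ) : ℝ := √(Real.log n * Real.log (Real.log n))

theorem tendsto_log_natCast : Tendsto (fun n : ℕ => Real.log n) atTop atTop :=
  Real.tendsto_log_atTop.comp tendsto_natCast_atTop_atTop

theorem tendsto_rateExponent : Tendsto rateExponent atTop atTop :=
  Real.tendsto_sqrt_atTop.comp (tendsto_log_natCast.atTop_mul_atTop₀
    (Real.tendsto_log_atTop.comp tendsto_log_natCast))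

theorem rateExponent_nonneg (n : ℕ) : 0 ≤ rateExponent n := Real.sqrt_nonneg _

theorem eventually_sqrt_mul_log_le {δ : ℝ} (hδ : 0 < δ) :
    ∀ᶠ x : ℝ in atTop, √(x * Real.log x) ≤ δ * x := by
  filter_upwards [Real.isLittleO_log_id_atTop.bound (show 0 < δ ^ 2 by positivity),
    eventually_ge_atTop 1] with x hx h1
  have h0 : 0 ≤ Real.log x := Real.log_nonneg h1
  rw [Real.norm_of_nonneg h0, id, Real.norm_of_nonneg (by linarith)] at hx
  refine Real.sqrt_le_iff.2 ⟨by positivity, ?_⟩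
  nlinarith

/-- Every term on the left is O(x^(1/2 - ε) log x), with constants adding up to 70, and log x ≤
(ε/70) x^ε for large x. -/
theorem eventually_rpow_mul_log_le {ε : ℝ} (hε : 0 < ε) (hε1 : ε < 1 / 4) :
    ∀ᶠ x : ℝ in atTop, Real.log 100 + 5 * Real.log x +
      5 * x ^ (1 / 2 - ε) * (8 + 4 * Real.log x) ≤ ε * √(x * Real.log x) := by
  filter_upwards [(isLittleO_log_rpow_atTop hε).bound (show 0 < ε / 70 by positivity),
    eventually_ge_atTop (Real.exp 1)] with x hx h1
  have hx1 : 1 ≤ x := (Real.one_le_exp zero_le_one).trans h1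
  have hx0 : 0 < x := by linarith
  have hl : 1 ≤ Real.log x := (Real.le_log_iff_exp_le hx0).2 h1
  rw [Real.norm_of_nonneg (by linarith), Real.norm_of_nonneg (by positivity)] at hx
  set z := x ^ (1 / 2 - ε) with hz
  have hz1 : 1 ≤ z := Real.one_le_rpow hx1 (by linarith)
  have h100 : Real.log 100 ≤ 5 := by
    rw [Real.log_le_iff_le_exp (by norm_num), show (5 : ℝ) = (5 : ℕ) * 1 by norm_num,
      Real.exp_nat_mul]
    have := Real.exp_one_gt_d9
    calc (100 : ℝ) ≤ 2.7 ^ 5 := by norm_num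
      _ ≤ _ := by gcongr; linarith
  have hs : z * x ^ ε = √x := by
    rw [hz, ← Real.rpow_add hx0, Real.sqrt_eq_rpow]; congr 1; ring
  have hs2 : √x ≤ √(x * Real.log x) := Real.sqrt_le_sqrt (by nlinarith)
  have hzl : 1 ≤ z * Real.log x := by nlinarith
  calc _ ≤ 70 * (z * Real.log x) := by nlinarith
    _ ≤ 70 * (z * (ε / 70 * x ^ ε)) := by gcongr
    _ = ε * √x := by rw [← hs]; ring
    _ ≤ _ := by gcongr

/-- The parameters chosen for n define a centre C that serves twice: for n itself with the full
error, and for all large m with the tail error alone, the sieve error then being O(1/m). -/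
theorem eventually_exists_center {ε : ℝ} (hε0 : 0 < ε) (hε1 : ε < 1 / 4) :
    ∀ᶠ n : ℕ in atTop, ∃ C, |logRate n - C| ≤ Real.exp (-(1 - 3 * ε) * rateExponent n) ∧
      ∀ η > 0, ∀ᶠ m in atTop,
        |logRate m - C| ≤ Real.exp (-(1 - 3 * ε) * rateExponent n) + η := by
  have hx : ∀ᶠ x : ℝ in atTop, 3 ≤ x ∧ 1 ≤ Real.log x ∧ 2 * √(x * Real.log x) + 1 ≤ x ∧
      2 * √(x * Real.log x) ≤ ε * x ∧ √(x * Real.log x) ≤ ε ^ 2 * x ∧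
      Real.log 100 + 5 * Real.log x + 5 * x ^ (1 / 2 - ε) * (8 + 4 * Real.log x) ≤
        ε * √(x * Real.log x) := by
    filter_upwards [eventually_ge_atTop 3, Real.tendsto_log_atTop.eventually_ge_atTop 1,
      eventually_sqrt_mul_log_le (show (0 : ℝ) < 1 / 4 by norm_num),
      eventually_sqrt_mul_log_le (show 0 < ε / 2 by positivity),
      eventually_sqrt_mul_log_le (show 0 < ε ^ 2 by positivity),
      eventually_rpow_mul_log_le hε0 hε1] with x h1 h2 h3 h4 h5 h6
    exact ⟨h1, h2, by linarith, by linarith, h5, h6⟩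
  filter_upwards [tendsto_log_natCast.eventually hx, eventually_ge_atTop 1] with n hn hn1
  obtain ⟨h3, hl, h1, h2, h4, h5⟩ := hn
  obtain ⟨I, S, q, θ, hq, hθ0, hθ1, h⟩ := exists_params hn1 rfl rfl hε0 hε1 h3 hl h1 h2 h4 h5
  refine ⟨totalCenter I S q, (abs_logRate_sub_le hq hθ0 hθ1 hn1).trans h, fun η hη => ?_⟩
  filter_upwards [eventually_abs_logRate_sub_le (S := S) hq hθ0 hθ1 hη] with m hm
  have : 0 ≤ sieveError I S q n / n := div_nonneg (sieveError_nonneg _ _ _ _) (Nat.cast_nonneg _)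
  have h' : tailError I S q θ + sieveError I S q n / n ≤
    Real.exp (-(1 - 3 * ε) * rateExponent n) := h
  linarith

theorem exists_tendsto_logRate : ∃ L, Tendsto logRate atTop (nhds L) := by
  refine exists_tendsto_of_centers
    (e := fun n => Real.exp (-(1 - 3 * (1 / 5)) * rateExponent n)) ?_
    (eventually_exists_center (by norm_num) (by norm_num))
  refine Real.tendsto_exp_atBot.comp ?_
  exact (tendsto_const_mul_atBot_of_neg (by norm_num)).2 tendsto_rateExponent

theorem exists_abs_logRate_sub_le {L : ℝ} (hL : Tendsto logRate atTop (nhds L)) {ε : ℝ}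
    (hε : 0 < ε) : ∃ K, 0 ≤ K ∧ ∀ n, |logRate n - L| ≤ K * Real.exp ((-1 + ε) * rateExponent n) := by
  set δ := min (ε / 3) (1 / 5) with hδ
  have hδ0 : 0 < δ := lt_min (by positivity) (by norm_num)
  have hδ1 : δ < 1 / 4 := (min_le_right _ _).trans_lt (by norm_num)
  have hδε : 3 * δ ≤ ε := by linarith [min_le_left (ε / 3) (1 / 5)]
  obtain ⟨N, hN⟩ := eventually_atTop.1 (eventually_exists_center hδ0 hδ1)
  set F : ℕ → ℝ := fun n => |logRate n - L| / Real.exp ((-1 + ε) * rateExponent n) with hF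
  have hF0 : ∀ n, 0 ≤ F n := fun n => by positivity
  have hS : 0 ≤ ∑ m ∈ Finset.range N, F m := Finset.sum_nonneg fun n _ => hF0 n
  -- The finitely many n < N are absorbed by adding their ratios to the constant.
  refine ⟨2 + ∑ m ∈ Finset.range N, F m, by linarith, fun n => ?_⟩
  rw [← div_le_iff₀ (Real.exp_pos _)]
  rcases lt_or_ge n N with h | h
  · have := Finset.single_le_sum (f := F) (fun m _ => hF0 m) (Finset.mem_range.2 h)
    change F n ≤ _
    linarith
  · obtain ⟨C, h1, h2⟩ := hN n h
    have h3 := abs_sub_lim_le_of_center hL h1 h2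
    have h4 : Real.exp (-(1 - 3 * δ) * rateExponent n) ≤
        Real.exp ((-1 + ε) * rateExponent n) :=
      Real.exp_le_exp.2 (mul_le_mul_of_nonneg_right (by linarith) (rateExponent_nonneg n))
    rw [div_le_iff₀ (Real.exp_pos _)]
    nlinarith [Real.exp_pos ((-1 + ε) * rateExponent n)]

/-- Exchange `j` and `2 * j` for every `j ∈ T`. -/
def doubleSwap (T : Finset ℕ) (x : ℕ) : ℕ :=
  if x ∈ T then 2 * x else if 2 ∣ x ∧ x / 2 ∈ T then x / 2 else x

theorem doubleSwap_involutive {T : Finset ℕ} (hT : ∀ x ∈ T, x % 2 = 1) :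
    Function.Involutive (doubleSwap T) := by
  intro x
  unfold doubleSwap
  by_cases h1 : x ∈ T
  · have h2 : 2 * x ∉ T := fun h => by have := hT _ h; omega
    simp [h1, h2]
  · by_cases h2 : 2 ∣ x ∧ x / 2 ∈ T
    · simp only [h1, h2, if_false, if_true, and_self]
      omega
    · simp [h1, h2]

theorem doubleSwap_mem {T : Finset ℕ} {n : ℕ} (hT : ∀ x ∈ T, 2 * x ≤ n) {x : ℕ}
    (hx : x ∈ Finset.Icc 1 n) : doubleSwap T x ∈ Finset.Icc 1 n := by
  rw [Finset.mem_Icc] at hx ⊢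
  unfold doubleSwap
  split_ifs with h1 h2
  · have := hT x h1; omega
  · omega
  · exact hx

theorem lcm_doubleSwap_le {T : Finset ℕ} {n : ℕ} (hT : ∀ x ∈ T, 2 * x ≤ n) {x : ℕ}
    (hx : x ≤ n) : Nat.lcm x (doubleSwap T x) ≤ n := by
  unfold doubleSwap
  split_ifs with h1 h2
  · rw [Nat.lcm_eq_right (dvd_mul_left x 2)]; exact hT x h1
  · rwa [Nat.lcm_eq_left (Nat.div_dvd_of_dvd h2.1)]
  · rwa [Nat.lcm_self]

theorem mem_iff_doubleSwap_eq {T : Finset ℕ} {x : ℕ} (hx : 0 < x) :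
    x ∈ T ↔ doubleSwap T x = 2 * x := by
  unfold doubleSwap
  split_ifs with h1 h2 <;> simp only [h1, false_iff] <;> omega

/-- The transpositions of j and 2j, for odd j with 2j ≤ n, are disjoint and may be chosen
independently; T is recovered as the set of x sent to 2x. -/
theorem two_pow_le_ncard_Slcm (n : ℕ) : 2 ^ (n / 4) ≤ (Slcm n).ncard := by
  classical
  set U : Finset ℕ := (Finset.range (n / 4)).image fun i => 2 * i + 1 with hU
  have hUc : U.card = n / 4 := by
    rw [hU, Finset.card_image_of_injective _ fun a b h => by simpa using h, Finset.card_range]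
  have hU1 : ∀ x ∈ U, x % 2 = 1 ∧ 2 * x ≤ n := by
    intro x hx
    obtain ⟨i, hi, rfl⟩ := Finset.mem_image.1 hx
    have := Finset.mem_range.1 hi
    omega
  have hP : ∀ T ∈ U.powerset, ∃ π ∈ Slcm n, ∀ j, (π j : ℕ) = doubleSwap T j := by
    intro T hT
    have hT1 : ∀ x ∈ T, x % 2 = 1 := fun x hx => (hU1 x (Finset.mem_powerset.1 hT hx)).1
    have hT2 : ∀ x ∈ T, 2 * x ≤ n := fun x hx => (hU1 x (Finset.mem_powerset.1 hT hx)).2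
    let f : Finset.Icc 1 n → Finset.Icc 1 n := fun x => ⟨doubleSwap T x, doubleSwap_mem hT2 x.2⟩
    have hf : Function.Involutive f := fun x => Subtype.ext (doubleSwap_involutive hT1 x)
    exact ⟨hf.toPerm, fun j => lcm_doubleSwap_le hT2 (Finset.mem_Icc.1 j.2).2, fun j => rfl⟩
  choose! g hg hg' using hP
  rw [← hUc, ← Finset.card_powerset, ← Set.ncard_coe_finset]
  refine Set.ncard_le_ncard_of_injOn g (fun T hT => hg T hT) ?_ (Set.toFinite _)
  intro T hT T' hT' h
  have key : ∀ x ∈ U, (x ∈ T ↔ x ∈ T') := by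
    intro x hx
    have := hU1 x hx
    have h1 := hg' T hT ⟨x, Finset.mem_Icc.2 ⟨by omega, by omega⟩⟩
    have h2 := hg' T' hT' ⟨x, Finset.mem_Icc.2 ⟨by omega, by omega⟩⟩
    rw [h] at h1
    rw [mem_iff_doubleSwap_eq (by omega), mem_iff_doubleSwap_eq (by omega)]
    rw [← h1, ← h2]
  ext x
  exact ⟨fun hx => (key x (Finset.mem_powerset.1 hT hx)).1 hx,
    fun hx => (key x (Finset.mem_powerset.1 hT' hx)).2 hx⟩

/-- Needed because the relative error δ in the exponent is (logRate n - L)/L. -/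
theorem lim_logRate_pos {L : ℝ} (hL : Tendsto logRate atTop (nhds L)) : 0 < L := by
  have h2 := Real.log_pos one_lt_two
  refine lt_of_lt_of_le (show 0 < Real.log 2 / 8 by positivity) (ge_of_tendsto hL ?_)
  filter_upwards [eventually_ge_atTop 4] with n hn
  have h1 : Real.log ((2 : ℝ) ^ (n / 4)) ≤ Real.log (Slcm n).ncard :=
    Real.log_le_log (by positivity) (by exact_mod_cast two_pow_le_ncard_Slcm n)
  have hn0 : (0 : ℝ) < n := by exact_mod_cast (by omega : 0 < n)
  rw [logRate, le_div_iff₀ hn0]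
  rw [Real.log_pow] at h1
  have h3 : (n : ℝ) ≤ 8 * (n / 4 : ℕ) := by exact_mod_cast (by omega : n ≤ 8 * (n / 4))
  nlinarith

theorem ncard_Slcm_pos (n : ℕ) : 0 < (Slcm n).ncard :=
  lt_of_lt_of_le (by positivity) (two_pow_le_ncard_Slcm n)

theorem exp_logRate (n : ℕ) :
    Real.exp (logRate n) = ((Slcm n).ncard : ℝ) ^ (1 / (n : ℝ)) := by
  rw [Real.rpow_def_of_pos (by exact_mod_cast ncard_Slcm_pos n), logRate, mul_one_div]

theorem exists_ncard_eq_rpow {L : ℝ} (hL : Tendsto logRate atTop (nhds L)) {ε : ℝ}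
    (hε : 0 < ε) : ∃ K : ℝ, ∀ n : ℕ, 0 < n → ∃ δ : ℝ,
      |δ| ≤ K * Real.exp ((-1 + ε) * rateExponent n) ∧
      ((Slcm n).ncard : ℝ) = Real.exp L ^ ((n : ℝ) * (1 + δ)) := by
  obtain ⟨K, -, hK⟩ := exists_abs_logRate_sub_le hL hε
  have hL0 := lim_logRate_pos hL
  refine ⟨K / L, fun n hn => ⟨(logRate n - L) / L, ?_, ?_⟩⟩
  · rw [abs_div, abs_of_pos hL0, div_mul_eq_mul_div]
    gcongr
    exact hK n
  · have hn0 : (n : ℝ) ≠ 0 := by exact_mod_cast hn.ne'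
    have hp : (0 : ℝ) < (Slcm n).ncard := by exact_mod_cast ncard_Slcm_pos n
    rw [← Real.exp_mul, logRate]
    rw [show L * (n * (1 + (Real.log (Slcm n).ncard / n - L) / L)) = Real.log (Slcm n).ncard by
      field_simp; ring, Real.exp_log hp]

end Limit

/-! ### Primitive recursive counting and root extraction. -/

section Computability

theorem primrec₂_pow : Primrec₂ fun m n : ℕ => m ^ n := Primrec₂.unpaired'.1 Nat.Primrec.pow

theorem PrimrecRel.forall_lt_comp {α : Type*} [Primcodable α] {R : ℕ → α → Prop} {f : α → ℕ}
    (hR : PrimrecRel R) (hf : Primrec f) : PrimrecPred fun a => ∀ x < f a, R x a :=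
  ((PrimrecRel.forall_mem_list hR).comp (Primrec.list_range.comp hf) Primrec.id).of_eq (by simp)

theorem PrimrecRel.exists_lt_comp {α : Type*} [Primcodable α] {R : ℕ → α → Prop} {f : α → ℕ}
    (hR : PrimrecRel R) (hf : Primrec f) : PrimrecPred fun a => ∃ x < f a, R x a :=
  ((PrimrecRel.exists_mem_list hR).comp (Primrec.list_range.comp hf) Primrec.id).of_eq (by simp)

/-- `x` encodes in base `n` the values of an element of `Slcm n`, everything shifted by one. -/
def IsLcmCode (x n : ℕ) : Prop :=
  ∀ i < n, (∃ m < n, (m + 1) % (i + 1) = 0 ∧ (m + 1) % (x / n ^ i % n + 1) = 0) ∧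
    ∀ j < n, x / n ^ i % n = x / n ^ j % n → i = j

theorem primrecRel_isLcmCode : PrimrecRel IsLcmCode := by
  have hdigit : Primrec fun p : ℕ × ℕ × ℕ => p.2.1 / p.2.2 ^ p.1 % p.2.2 :=
    Primrec.nat_mod.comp (Primrec.nat_div.comp (Primrec.fst.comp .snd)
      (primrec₂_pow.comp (Primrec.snd.comp .snd) .fst)) (Primrec.snd.comp .snd)
  have hdvd : ∀ {α : Type} [Primcodable α] {f g : α → ℕ}, Primrec f → Primrec g →
      PrimrecPred fun a => (f a + 1) % (g a + 1) = 0 := fun hf hg =>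
    Primrec.eq.comp (Primrec.nat_mod.comp (Primrec.succ.comp hf) (Primrec.succ.comp hg)) (.const 0)
  have h1 : PrimrecRel fun (i : ℕ) (p : ℕ × ℕ) => ∃ m < p.2,
      (m + 1) % (i + 1) = 0 ∧ (m + 1) % (p.1 / p.2 ^ i % p.2 + 1) = 0 := by
    refine PrimrecRel.exists_lt_comp (α := ℕ × ℕ × ℕ)
      (R := fun m q => (m + 1) % (q.1 + 1) = 0 ∧ (m + 1) % (q.2.1 / q.2.2 ^ q.1 % q.2.2 + 1) = 0)
      ?_ (Primrec.snd.comp .snd)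
    exact (hdvd .fst (Primrec.fst.comp .snd)).and (hdvd .fst (hdigit.comp .snd))
  have h2 : PrimrecRel fun (i : ℕ) (p : ℕ × ℕ) => ∀ j < p.2,
      p.1 / p.2 ^ i % p.2 = p.1 / p.2 ^ j % p.2 → i = j := by
    refine PrimrecRel.forall_lt_comp (α := ℕ × ℕ × ℕ)
      (R := fun j q => q.2.1 / q.2.2 ^ q.1 % q.2.2 = q.2.1 / q.2.2 ^ j % q.2.2 → q.1 = j)
      ?_ (Primrec.snd.comp .snd)
    refine (((Primrec.eq.comp (hdigit.comp .snd)
      (hdigit.comp (Primrec.pair .fst (Primrec.snd.comp .snd)))).not).or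
      (Primrec.eq.comp (Primrec.fst.comp .snd) .fst)).of_eq fun q => ?_
    exact imp_iff_not_or.symm
  exact PrimrecRel.forall_lt_comp (α := ℕ × ℕ)
    (R := fun i p => (∃ m < p.2, (m + 1) % (i + 1) = 0 ∧
      (m + 1) % (p.1 / p.2 ^ i % p.2 + 1) = 0) ∧
      ∀ j < p.2, p.1 / p.2 ^ i % p.2 = p.1 / p.2 ^ j % p.2 → i = j) (h1.and h2) Primrec.snd

/-- The elements of `{1, …, n}`, shifted by one. -/
def finEquivIcc (n : ℕ) : Fin n ≃ Finset.Icc 1 n where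
  toFun i := ⟨i + 1, Finset.mem_Icc.2 ⟨by omega, i.2⟩⟩
  invFun x := ⟨x - 1, by have := Finset.mem_Icc.1 x.2; omega⟩
  left_inv i := by simp
  right_inv x := by have := Finset.mem_Icc.1 x.2; apply Subtype.ext; simp only; omega

/-- A bounded search for a common multiple replaces the lcm, so that the code predicate is visibly
primitive recursive. -/
theorem exists_common_multiple_iff {a b n : ℕ} :
    (∃ m < n, (m + 1) % (a + 1) = 0 ∧ (m + 1) % (b + 1) = 0) ↔
      Nat.lcm (a + 1) (b + 1) ≤ n := by
  constructor
  · rintro ⟨m, hm, h1, h2⟩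
    exact (Nat.le_of_dvd m.succ_pos (Nat.lcm_dvd (Nat.dvd_of_mod_eq_zero h1)
      (Nat.dvd_of_mod_eq_zero h2))).trans hm
  · intro h
    have h0 : 0 < Nat.lcm (a + 1) (b + 1) := Nat.lcm_pos a.succ_pos b.succ_pos
    refine ⟨Nat.lcm (a + 1) (b + 1) - 1, by omega, ?_⟩
    rw [Nat.sub_add_cancel h0]
    exact ⟨Nat.mod_eq_zero_of_dvd (Nat.dvd_lcm_left _ _),
      Nat.mod_eq_zero_of_dvd (Nat.dvd_lcm_right _ _)⟩

theorem isLcmCode_iff {n : ℕ} (f : Fin n → Fin n) :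
    IsLcmCode (finFunctionFinEquiv f) n ↔
      (∀ i : Fin n, Nat.lcm (i + 1) (f i + 1) ≤ n) ∧ Function.Injective f := by
  have hd : ∀ i : Fin n, (finFunctionFinEquiv f : ℕ) / n ^ (i : ℕ) % n = f i := fun i =>
    congrArg (fun g => (g i : ℕ)) (finFunctionFinEquiv.symm_apply_apply f)
  unfold IsLcmCode
  simp only [exists_common_multiple_iff]
  constructor
  · intro h
    refine ⟨fun i => ?_, fun i j hij => ?_⟩
    · have := (h i i.2).1
      rwa [hd] at this
    · have := (h i i.2).2 j j.2
      rw [hd, hd] at this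
      exact Fin.ext (this (congrArg _ hij))
  · rintro ⟨h1, h2⟩ i hi
    have hi' := hd ⟨i, hi⟩
    simp only at hi'
    rw [hi']
    refine ⟨h1 ⟨i, hi⟩, fun j hj hij => ?_⟩
    have hj' := hd ⟨j, hj⟩
    simp only at hj'
    rw [hj'] at hij
    exact congrArg Fin.val (h2 (Fin.ext hij))

theorem ncard_Slcm_eq_codes (n : ℕ) : (Slcm n).ncard = {x | x < n ^ n ∧ IsLcmCode x n}.ncard := by
  set e := finEquivIcc n
  refine Set.ncard_congr
    (fun π _ => (finFunctionFinEquiv (fun i : Fin n => e.symm (π (e i))) : ℕ)) ?_ ?_ ?_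
  · intro π hπ
    refine ⟨Fin.is_lt _, (isLcmCode_iff _).2 ⟨fun i => ?_, ?_⟩⟩
    · have h1 := hπ (e i)
      have h2 : ((e.symm (π (e i)) : Fin n) : ℕ) + 1 = π (e i) :=
        congrArg Subtype.val (e.apply_symm_apply (π (e i)))
      rw [h2]
      exact h1
    · exact e.symm.injective.comp (π.injective.comp e.injective)
  · intro π π' _ _ h
    have h1 := finFunctionFinEquiv.injective (Fin.ext h)
    ext x
    have h2 := congrFun h1 (e.symm x)
    simp only [Equiv.apply_symm_apply, EmbeddingLike.apply_eq_iff_eq] at h2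
    rw [h2]
  · rintro x ⟨hx, hc⟩
    obtain ⟨f, hf⟩ := finFunctionFinEquiv.surjective (⟨x, hx⟩ : Fin (n ^ n))
    have hfx : (finFunctionFinEquiv f : ℕ) = x := congrArg Fin.val hf
    rw [← hfx, isLcmCode_iff] at hc
    have hb : Function.Bijective f := Finite.injective_iff_bijective.1 hc.2
    refine ⟨(e.symm.trans (Equiv.ofBijective f hb)).trans e, fun j => ?_, ?_⟩
    · obtain ⟨i, rfl⟩ := e.surjective j
      simp only [Equiv.trans_apply, Equiv.symm_apply_apply]
      exact hc.1 i
    · simp only [Equiv.trans_apply, Equiv.symm_apply_apply]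
      exact hfx

theorem primrec_ncard_Slcm : Primrec fun n => (Slcm n).ncard := by
  classical
  have h : Primrec fun n : ℕ => ((List.range (n ^ n)).filter fun x => IsLcmCode x n).length :=
    Primrec.list_length.comp ((PrimrecRel.listFilter primrecRel_isLcmCode).comp
      (Primrec.list_range.comp (primrec₂_pow.comp .id .id)) .id)
  refine h.of_eq fun n => ?_
  rw [ncard_Slcm_eq_codes, ← List.toFinset_card_of_nodup (List.nodup_range.filter _),
    ← Set.ncard_coe_finset]
  congr 1
  ext x
  simp

/-- The integer part of `2 ^ k` times the `n`-th root of `#(Slcm n)`. -/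
noncomputable def scaledRoot (n k : ℕ) : ℕ :=
  Nat.findGreatest (fun m => m ^ n ≤ (2 ^ k) ^ n * (Slcm n).ncard) (2 ^ k * (Slcm n).ncard)

theorem primrec₂_scaledRoot : Primrec₂ scaledRoot := by
  have h2 : Primrec fun p : ℕ × ℕ => 2 ^ p.2 := primrec₂_pow.comp (.const 2) .snd
  have hs : Primrec fun p : ℕ × ℕ => (Slcm p.1).ncard := primrec_ncard_Slcm.comp .fst
  refine Primrec.nat_findGreatest (α := ℕ × ℕ)
    (p := fun p m => m ^ p.1 ≤ (2 ^ p.2) ^ p.1 * (Slcm p.1).ncard)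
    (Primrec.nat_mul.comp h2 hs) ?_
  exact Primrec.nat_le.comp (primrec₂_pow.comp .snd (Primrec.fst.comp .fst))
    (Primrec.nat_mul.comp (primrec₂_pow.comp (h2.comp .fst) (Primrec.fst.comp .fst))
      (hs.comp .fst))

theorem scaledRoot_bounds {n : ℕ} (hn : 0 < n) (k : ℕ) :
    (scaledRoot n k : ℝ) ≤ 2 ^ k * ((Slcm n).ncard : ℝ) ^ (1 / (n : ℝ)) ∧
      2 ^ k * ((Slcm n).ncard : ℝ) ^ (1 / (n : ℝ)) ≤ scaledRoot n k + 1 := by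
  set s := (Slcm n).ncard with hs
  have hs1 : 1 ≤ s := ncard_Slcm_pos n
  set a : ℝ := (s : ℝ) ^ (1 / (n : ℝ)) with ha
  have ha0 : 0 ≤ a := by positivity
  have han : a ^ n = s := by
    rw [ha, one_div]; exact Real.rpow_inv_natCast_pow (Nat.cast_nonneg _) hn.ne'
  have hy : (2 ^ k * a) ^ n = (2 ^ k) ^ n * s := by rw [mul_pow, han]
  have hspec : scaledRoot n k ^ n ≤ (2 ^ k) ^ n * s :=
    Nat.findGreatest_spec (P := fun m => m ^ n ≤ (2 ^ k) ^ n * s) (Nat.zero_le _)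
      (by simp [hn.ne'])
  constructor
  · refine le_of_pow_le_pow_left₀ hn.ne' (by positivity) ?_
    rw [hy]
    exact_mod_cast hspec
  · by_contra! hlt
    have h1 : ((scaledRoot n k + 1 : ℕ) : ℝ) ^ n ≤ (2 ^ k) ^ n * s := by
      rw [← hy]; push_cast; gcongr
    have h2 : (scaledRoot n k + 1) ^ n ≤ (2 ^ k) ^ n * s := by exact_mod_cast h1
    -- The search bound of `scaledRoot` loses nothing: m^n ≤ (2^k)^n s ≤ (2^k s)^n.
    have h3 : scaledRoot n k + 1 ≤ 2 ^ k * s := by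
      refine le_of_pow_le_pow_left₀ hn.ne' (by positivity) (h2.trans ?_)
      rw [mul_pow]
      exact Nat.mul_le_mul_left _ (Nat.le_self_pow hn.ne' s)
    have h4 : scaledRoot n k + 1 ≤ scaledRoot n k := Nat.le_findGreatest h3 h2
    omega

/-- A real number is computable if the roots `#(Slcm n) ^ (1 / n)` approximate it along a
primitive recursive sequence with a guaranteed precision. -/
theorem isComputableReal_of_approx {c : ℝ} {N : ℕ → ℕ} (hN : Primrec N) (hpos : ∀ k, 0 < N k)
    (h : ∀ k, |((Slcm (N k)).ncard : ℝ) ^ (1 / (N k : ℝ)) - c| ≤ 1 / 2 ^ (k + 1)) :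
    IsComputableReal c := by
  -- The root is computed with one extra bit and then halved with rounding, for an error of
  -- 2^(-(k+1)); the distance from the root to c uses the other half.
  refine ⟨fun k => (((scaledRoot (N k) (k + 1) + 1) / 2 : ℕ) : ℤ), ?_, fun k => ?_⟩
  · have h1 : Primrec fun k => (scaledRoot (N k) (k + 1) + 1) / 2 :=
      Primrec.nat_div.comp (Primrec.succ.comp (primrec₂_scaledRoot.comp hN Primrec.succ)) (.const 2)
    have h2 : Primrec fun m : ℕ => (m : ℤ) :=
      Primrec.encode_iff.1 (Primrec.nat_double.of_eq fun m => rfl)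
    exact (h2.comp h1).to_comp
  · obtain ⟨h1, h2⟩ := scaledRoot_bounds (hpos k) (k + 1)
    have h3 := h k
    set a := ((Slcm (N k)).ncard : ℝ) ^ (1 / (N k : ℝ))
    set g := scaledRoot (N k) (k + 1)
    have h4 : (g : ℝ) ≤ 2 * ((g + 1) / 2 : ℕ) := by exact_mod_cast (by omega : g ≤ 2 * ((g + 1) / 2))
    have h5 : 2 * (((g + 1) / 2 : ℕ) : ℝ) ≤ g + 1 := by
      exact_mod_cast (by omega : 2 * ((g + 1) / 2) ≤ g + 1)
    have h6 : (0 : ℝ) < 2 ^ k := by positivity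
    rw [pow_succ] at h1 h2 h3
    rw [Int.cast_natCast]
    set m : ℝ := (((g + 1) / 2 : ℕ) : ℝ)
    have h7 : |a - m / 2 ^ k| ≤ 1 / (2 ^ k * 2) := by
      rw [show a - m / 2 ^ k = (2 ^ k * 2 * a - 2 * m) / (2 ^ k * 2) by field_simp, abs_div,
        abs_of_pos (show (0 : ℝ) < 2 ^ k * 2 by positivity)]
      gcongr
      rw [abs_le]
      constructor <;> linarith
    have h8 := abs_sub_le c a (m / 2 ^ k)
    rw [abs_sub_comm c a] at h8
    have h9 : (1 : ℝ) / 2 ^ k = 1 / (2 ^ k * 2) + 1 / (2 ^ k * 2) := by field_simp; norm_num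
    linarith

end Computability

/-! ### Effective precision and conclusion. -/

section Main

open Filter

theorem abs_exp_sub_exp_le {a b B : ℝ} (ha : a ≤ B) (hb : b ≤ B) :
    |Real.exp a - Real.exp b| ≤ Real.exp B * |a - b| := by
  wlog h : b ≤ a generalizing a b
  · rw [abs_sub_comm, abs_sub_comm a]
    exact this hb ha (le_of_not_ge h)
  rw [abs_of_nonneg (sub_nonneg.2 (Real.exp_le_exp.2 h)), abs_of_nonneg (sub_nonneg.2 h)]
  have h1 := Real.add_one_le_exp (b - a)
  have h2 : Real.exp b = Real.exp a * Real.exp (b - a) := by rw [← Real.exp_add]; ring_nf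
  calc Real.exp a - Real.exp b = Real.exp a * (1 - Real.exp (b - a)) := by rw [h2]; ring
    _ ≤ Real.exp a * (a - b) :=
      mul_le_mul_of_nonneg_left (by linarith) (Real.exp_pos a).le
    _ ≤ Real.exp B * (a - b) :=
      mul_le_mul_of_nonneg_right (Real.exp_le_exp.2 ha) (sub_nonneg.2 h)

/-- For n = 2^(M²), log n is M² log 2, so the square root is at least of order M. This gives a
primitive recursive n with exponentially small error. -/
theorem le_rateExponent_two_pow_sq {M : ℕ} (hM : 4 ≤ M) :
    (M : ℝ) / 2 ≤ rateExponent (2 ^ M ^ 2) := by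
  have hl := Real.log_two_gt_d9
  have hM' : (4 : ℝ) ≤ M := by exact_mod_cast hM
  apply Real.le_sqrt_of_sq_le
  have h1 : Real.log ((2 ^ M ^ 2 : ℕ) : ℝ) = M ^ 2 * Real.log 2 := by
    push_cast; rw [Real.log_pow]; push_cast; rfl
  rw [h1]
  have h2 : 4 ≤ M ^ 2 * Real.log 2 := by nlinarith
  have h3 : 1 ≤ Real.log (M ^ 2 * Real.log 2) := by
    rw [Real.le_log_iff_exp_le (by linarith)]
    linarith [Real.exp_one_lt_d9]
  calc ((M : ℝ) / 2) ^ 2 ≤ M ^ 2 * Real.log 2 := by nlinarith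
    _ ≤ _ := le_mul_of_one_le_right (by linarith) h3

theorem isComputableReal_exp_lim {L : ℝ} (hL : Tendsto logRate atTop (nhds L)) :
    IsComputableReal (Real.exp L) := by
  obtain ⟨K, hK0, hK⟩ := exists_abs_logRate_sub_le hL (show (0 : ℝ) < 1 / 2 by norm_num)
  obtain ⟨B, hB⟩ := hL.bddAbove_range
  have hB' : ∀ n, logRate n ≤ B := fun n => hB ⟨n, rfl⟩
  have hLB : L ≤ B := le_of_tendsto' hL hB'
  set D := max (Real.exp B * K) 1 with hD
  have hD1 : 1 ≤ D := le_max_right _ _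
  obtain ⟨A, hA⟩ := exists_nat_ge (4 * Real.log (2 * D))
  have hAexp : Real.exp (-((A + 4 : ℕ) : ℝ) / 4) ≤ 1 / (2 * D) := by
    rw [one_div, ← Real.exp_log (show 0 < 2 * D by linarith), ← Real.exp_neg]
    apply Real.exp_le_exp.2
    push_cast
    linarith
  -- With M = (A+4)(k+1), the error factor is at most exp(-M/4) ≤ (1/(2D))^(k+1), which absorbs D
  -- and leaves 2^(-(k+1)). The algorithm uses only the fixed number A, so the mere existence of K
  -- and B suffices.
  refine isComputableReal_of_approx (N := fun k => 2 ^ ((A + 4) * (k + 1)) ^ 2) ?_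
    (fun k => by positivity) fun k => ?_
  · exact primrec₂_pow.comp (.const 2) (primrec₂_pow.comp
      (Primrec.nat_mul.comp (.const _) Primrec.succ) (.const 2))
  · have hM : 4 ≤ (A + 4) * (k + 1) := by nlinarith
    have h1 := le_rateExponent_two_pow_sq hM
    have h2 := hK (2 ^ ((A + 4) * (k + 1)) ^ 2)
    rw [← exp_logRate]
    refine (abs_exp_sub_exp_le (hB' _) hLB).trans ?_
    have h3 : Real.exp ((-1 + 1 / 2) * rateExponent (2 ^ ((A + 4) * (k + 1)) ^ 2)) ≤
        (1 / (2 * D)) ^ (k + 1) := by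
      calc _ ≤ Real.exp (((k + 1 : ℕ) : ℝ) * (-((A + 4 : ℕ) : ℝ) / 4)) := by
            apply Real.exp_le_exp.2
            push_cast at h1 ⊢
            linarith
        _ = Real.exp (-((A + 4 : ℕ) : ℝ) / 4) ^ (k + 1) := Real.exp_nat_mul _ _
        _ ≤ _ := by gcongr
    calc _ ≤ Real.exp B * (K * (1 / (2 * D)) ^ (k + 1)) := by
          gcongr; exact h2.trans (by gcongr)
      _ ≤ D * (1 / (2 * D)) ^ (k + 1) := by
          rw [← mul_assoc]; gcongr; exact le_max_left _ _
      _ ≤ D ^ (k + 1) * (1 / (2 * D)) ^ (k + 1) := by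
          gcongr; exact le_self_pow₀ hD1 k.succ_ne_zero
      _ = 1 / 2 ^ (k + 1) := by
          rw [← mul_pow, ← one_div_pow]; congr 1; field_simp

end Main

theorem theorem2p3 :
    ∃ c : ℝ,
      Filter.Tendsto (fun n : ℕ => ((Slcm n).ncard : ℝ) ^ (1 / (n : ℝ))) Filter.atTop (nhds c) ∧
      IsComputableReal c ∧
      ∀ ε : ℝ, 0 < ε → ∃ K : ℝ, ∀ n : ℕ, 3 ≤ n → ∃ δ : ℝ,
        |δ| ≤ K * Real.exp ((-1 + ε) * √(Real.log n * Real.log (Real.log n))) ∧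
        ((Slcm n).ncard : ℝ) = c ^ ((n : ℝ) * (1 + δ)) := by
  obtain ⟨L, hL⟩ := exists_tendsto_logRate
  refine ⟨Real.exp L, ?_, isComputableReal_exp_lim hL, fun ε hε => ?_⟩
  · exact ((Real.continuous_exp.tendsto L).comp hL).congr exp_logRate
  · obtain ⟨K, hK⟩ := exists_ncard_eq_rpow hL hε
    exact ⟨K, fun n hn => hK n (by omega)⟩
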